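/- \textbf{Setting.} An $s$-stage NPRK method $(a_{ijk},b_{ij})$ applied to $y'=F(y,y)$ on $\mathbb{R}^d$ computes $$Y_i=y_n+h\sum_{j,k=1}^s a_{ijk}F(Y_j,Y_k)\ (1\le i\le s),\qquad y_{n+1}=y_n+h\sum_{i,j=1}^s b_{ij}F(Y_i,Y_j).$$ It has \emph{order $p$} (meaning at least $p$) if for every $d$, every $C^\infty$ function $F:\mathbb{R}^d\times\mathbb{R}^d\to\mathbb{R}^d$ and every exact solution $y$ near $t=0$ the following holds: there are $r,h_0>0$ and $C$ such that for all $0<h\le h_0$ the stage equations with $y_n=y(0)$ have a solution with $\|Y_i-y(0)\|\le r$ for all $i$, and every such solution gives $\|y_{n+1}-y(h)\|\le Ch^{p+1}$. The order of a classical RK method $(A,b)$ is defined in the same way for $y'=G(y)$. The NPRK method is \emph{stiffly accurate} if $b_{jk}=a_{sjk}$ for all $j,k$ (so $y_{n+1}=Y_s$). With $A^{\{1\}}_{ij}=\sum_k a_{ijk}$, $A^{\{2\}}_{ik}=\sum_j a_{ijk}$, $b^{\{1\}}_i=\sum_j b_{ij}$, $b^{\{2\}}_j=\sum_i b_{ij}$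 and $e=(1,\dots,1)^T$, its stability function is $$R(z_1,z_2)=\frac{\det\bigl(I-z_1A^{\{1\}}-z_2A^{\{2\}}+e(z_1b^{\{1\}}+z_2b^{\{2\}})^T\bigr)}{\det\bigl(I-z_1A^{\{1\}}-z_2A^{\{2\}}\bigr)},$$ and it is \emph{L-stable in the stiff $z_1$ limit} if for every fixed $z_2\in\mathbb{C}$ the denominator is nonzero for all large $|z_1|$, $z_1\in\mathbb C$, and $\lim_{|z_1|\to\infty}R(z_1,z_2)=0$. Let $(A,b)$ be an explicit ($A$ strictly lower triangular) $n$-stage RK method with real coefficients, $A=(\alpha_{ij})$, and let $c_i=\sum_j\alpha_{ij}$. \textbf{(A) Second order.} Suppose $(A,b)$ has order $2$, and let $\gamma=\frac{2+\sqrt2}{2}$ or $\gamma=\frac{2-\sqrt2}{2}$. With $s=n+2$, the method \begin{align*} Y_1&=y_n,\qquad Y_2=y_n+h\gamma F(Y_2,Y_1),\\ Y_i&=y_n+h\alpha_{i-1,1}F(Y_2,Y_1)+h\sum_{k=3}^{i-1}\alpha_{i-1,k-1}F(Y_2,Y_k),\quad 3\le i\le n+1,\\ Y_s&=y_n+hb_1F(Y_2,Y_1)+h\sum_{k=3}^{n}b_{k-1}F(Y_2,Y_k)+h\bigl[(b_n-\gamma)F(Y_2,Y_{s-1})+\gamma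 F(Y_s,Y_{s-1})\bigr],\\ y_{n+1}&=Y_s \end{align*} has order $2$, is stiffly accurate and is L-stable in the stiff $z_1$ limit. \textbf{(B) Third order.} Suppose $(A,b)$ has order $3$ and $c_n\neq0$. Let $\lambda\in(0.4358,0.4359)$ be the root of $\frac16-\frac32\lambda+3\lambda^2-\lambda^3$, and let $\hat a_{11}=\hat a_{22}=\hat a_{33}=\lambda$, $\hat a_{21}=\frac12(1-\lambda)$, $\hat a_{31}=\frac14(-6\lambda^2+16\lambda-1)$, $\hat a_{32}=\frac14(6\lambda^2-20\lambda+5)$, $\hat c_1=\lambda$, $\hat c_2=\frac12(1+\lambda)$ be the coefficients of the three-stage stiffly accurate SDIRK method with this $\lambda$. Let $\omega\in\{1,2\}$, $s=n+3$, and $$a_{322}=\frac{2-6\lambda}{18\lambda^3-60\lambda^2+15\lambda}\ (\omega=1),\qquad a_{322}=\frac{2-6\lambda}{18\lambda^3-60\lambda^2+15\lambda}-\lambda\ (\omega=2).$$ In both methods below, \begin{align*} Y_1&=y_n,\qquad Y_2=y_n+h\hat a_{11}F(Y_2,Y_1),\\ Y_3&=y_n+h\bigl[(\hat a_{21}-a_{322})F(Y_2,Y_1)+a_{322}F(Y_2,Y_2)+\hat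 a_{22}F(Y_3,Y_\omega)\bigr],\\ Y_s&=y_n+h(b_1-\sigma)F(Y_2,Y_1)+h\sigma F(Y_3,Y_1)+h\sum_{k=4}^{s-2}b_{k-2}\bigl[(1-\theta)F(Y_2,Y_k)+\theta F(Y_3,Y_k)\bigr]\\ &\quad+h(b_n-\tau-\hat a_{33})F(Y_2,Y_{s-1})+h\tau F(Y_3,Y_{s-1})+h\hat a_{33}F(Y_s,Y_{s-1}),\qquad y_{n+1}=Y_s, \end{align*} and the remaining stages and coefficients are as follows. \emph{Method 1} (requires in addition $b_n\ne0$): $\theta=0$ and \begin{align*} Y_i&=y_n+h\sum_{1\le k\le i-1,\,k\ne2,3}\alpha_{i-2,\max(k-2,1)}F(Y_2,Y_k),\quad 4\le i\le n+1,\\ Y_{n+2}&=y_n+h\sum_{1\le k\le n,\,k\neq 2,3}\alpha_{n,\max(k-2,1)}F(Y_2,Y_k)+h\bigl[(\alpha_{n,n-1}-\eta)F(Y_2,Y_{n+1})+\eta F(Y_3,Y_{n+1})\bigr],\\ \eta&=\frac{1-3\hat c_1}{6b_n(\hat c_2-\hat c_1)},\qquad \sigma=\frac{\frac13-\hat a_{33}c_n+\hat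 c_1(\hat a_{33}c_n-\frac12)-\hat a_{32}(\hat c_2-\hat c_1)c_n}{(\hat c_1-\hat c_2)c_n},\qquad \tau=\hat a_{32}-\sigma. \end{align*} \emph{Method 2}: $\theta=\delta=\dfrac{2(3\lambda-1)}{3(\lambda-1)}$ and \begin{align*} Y_i&=y_n+h\sum_{1\le k\le i-1,\,k\ne2,3}\alpha_{i-2,\max(k-2,1)}\bigl[(1-\delta)F(Y_2,Y_k)+\delta F(Y_3,Y_k)\bigr],\quad 4\le i\le n+2,\\ X_1&=\hat a_{32}-\delta(1-b_1-b_n),\quad X_3=b_n-X_1,\quad X_4=\tfrac12-b_nc_n,\\ N_1&=(1-\delta)X_4+c_n(X_3-\hat a_{33}),\quad N_2=\delta X_4+c_nX_1,\\ \sigma&=\frac{\frac13-\hat a_{33}c_n-\hat c_1N_1-\hat c_2N_2}{(\hat c_1-\hat c_2)c_n},\qquad \tau=X_1-\sigma. \end{align*} Then Method 1 (if $b_n\neq0$) and Method 2 have order $3$, are stiffly accurate and are L-stable in the stiff $z_1$ limit. -/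

import Mathlib

open Filter Topology
open scoped ContDiff

/-- A classical Runge--Kutta method whose stages are labelled by a finite type `ι`. -/
structure RKMethod (ι : Type) where
  A : Matrix ι ι ℝ
  b : ι → ℝ

/-- A nonlinearly partitioned Runge--Kutta (NPRK) method whose stages are labelled by a finite
type `ι`: a third-order coefficient tensor and a weight matrix. -/
structure NPRKMethod (ι : Type) where
  a : ι → ι → ι → ℝ
  b : ι → ι → ℝ

namespace RKMethod

/-- The abscissae `c i = ∑ j, A i j`. -/
def c {ι : Type} [Fintype ι] (M : RKMethod ι) (i : ι) : ℝ := ∑ j, M.A i j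

/-- An explicit method: `A` is strictly lower triangular. -/
def IsExplicit {s : ℕ} (M : RKMethod (Fin s)) : Prop := ∀ i j, i ≤ j → M.A i j = 0

/-- `Y` solves the stage equations `Y i = y₀ + h ∑ j, A i j G (Y j)`. -/
def IsStages {ι : Type} [Fintype ι] {d : ℕ} (M : RKMethod ι)
    (G : (Fin d → ℝ) → (Fin d → ℝ)) (y₀ : Fin d → ℝ) (h : ℝ) (Y : ι → Fin d → ℝ) : Prop :=
  ∀ i, Y i = y₀ + h • ∑ j, M.A i j • G (Y j)

/-- The new value `y₁ = y₀ + h ∑ i, b i G (Y i)`. -/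
def output {ι : Type} [Fintype ι] {d : ℕ} (M : RKMethod ι)
    (G : (Fin d → ℝ) → (Fin d → ℝ)) (y₀ : Fin d → ℝ) (h : ℝ) (Y : ι → Fin d → ℝ) : Fin d → ℝ :=
  y₀ + h • ∑ i, M.b i • G (Y i)

/-- The method has order (at least) `p`: for every smooth autonomous system `y' = G y` on `ℝᵈ` and
every exact solution `y` near time `0`, for all small step sizes `h > 0` the stage equations have a
solution near `y 0`, and with any such stages one step from `y 0` has local error `O(h ^ (p + 1))`.
(All norms on `ℝᵈ` are equivalent, so the choice of norm is immaterial.) -/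
def HasOrder {ι : Type} [Fintype ι] (M : RKMethod ι) (p : ℕ) : Prop :=
  ∀ (d : ℕ) (G : (Fin d → ℝ) → (Fin d → ℝ)), ContDiff ℝ ∞ G →
    ∀ y : ℝ → Fin d → ℝ, (∀ᶠ t in 𝓝 0, HasDerivAt y (G (y t)) t) →
      ∃ r > 0, ∃ h₀ > 0, ∃ C : ℝ, ∀ h : ℝ, 0 < h → h ≤ h₀ →
        (∃ Y : ι → Fin d → ℝ, M.IsStages G (y 0) h Y ∧ ∀ i, ‖Y i - y 0‖ ≤ r) ∧
        ∀ Y : ι → Fin d → ℝ, M.IsStages G (y 0) h Y → (∀ i, ‖Y i - y 0‖ ≤ r) →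
          ‖M.output G (y 0) h Y - y h‖ ≤ C * h ^ (p + 1)

end RKMethod

namespace NPRKMethod

/-- `Y` solves the stage equations `Y i = y₀ + h ∑ j, ∑ k, a i j k F (Y j) (Y k)`. -/
def IsStages {ι : Type} [Fintype ι] {d : ℕ} (M : NPRKMethod ι)
    (F : (Fin d → ℝ) → (Fin d → ℝ) → (Fin d → ℝ)) (y₀ : Fin d → ℝ) (h : ℝ)
    (Y : ι → Fin d → ℝ) : Prop :=
  ∀ i, Y i = y₀ + h • ∑ j, ∑ k, M.a i j k • F (Y j) (Y k)

/-- The new value `y₁ = y₀ + h ∑ i, ∑ j, b i j F (Y i) (Y j)`. -/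
def output {ι : Type} [Fintype ι] {d : ℕ} (M : NPRKMethod ι)
    (F : (Fin d → ℝ) → (Fin d → ℝ) → (Fin d → ℝ)) (y₀ : Fin d → ℝ) (h : ℝ)
    (Y : ι → Fin d → ℝ) : Fin d → ℝ :=
  y₀ + h • ∑ i, ∑ j, M.b i j • F (Y i) (Y j)

/-- The method has order (at least) `p`: for every smooth nonlinear partition `F u v` on `ℝᵈ` and
every exact solution of `y' = F y y` near time `0`, for all small step sizes `h > 0` the stage
equations have a solution near `y 0`, and with any such stages one step from `y 0` has local error
`O(h ^ (p + 1))`. -/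
def HasOrder {ι : Type} [Fintype ι] (M : NPRKMethod ι) (p : ℕ) : Prop :=
  ∀ (d : ℕ) (F : (Fin d → ℝ) → (Fin d → ℝ) → (Fin d → ℝ)),
    ContDiff ℝ ∞ (Function.uncurry F) →
    ∀ y : ℝ → Fin d → ℝ, (∀ᶠ t in 𝓝 0, HasDerivAt y (F (y t) (y t)) t) →
      ∃ r > 0, ∃ h₀ > 0, ∃ C : ℝ, ∀ h : ℝ, 0 < h → h ≤ h₀ →
        (∃ Y : ι → Fin d → ℝ, M.IsStages F (y 0) h Y ∧ ∀ i, ‖Y i - y 0‖ ≤ r) ∧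
        ∀ Y : ι → Fin d → ℝ, M.IsStages F (y 0) h Y → (∀ i, ‖Y i - y 0‖ ≤ r) →
          ‖M.output F (y 0) h Y - y h‖ ≤ C * h ^ (p + 1)

/-- The (unreduced) underlying method for the first argument, seen by `F u v = G u`. -/
def underlying₁ {ι : Type} [Fintype ι] (M : NPRKMethod ι) : RKMethod ι where
  A := Matrix.of fun i j => ∑ k, M.a i j k
  b := fun i => ∑ j, M.b i j

/-- The (unreduced) underlying method for the second argument, seen by `F u v = G v`. -/
def underlying₂ {ι : Type} [Fintype ι] (M : NPRKMethod ι) : RKMethod ι where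
  A := Matrix.of fun i k => ∑ j, M.a i j k
  b := fun j => ∑ i, M.b i j

/-- The matrix `z₁ A₁ + z₂ A₂` of the underlying additive method. -/
noncomputable def stabMatrix {ι : Type} [Fintype ι] (M : NPRKMethod ι) (z₁ z₂ : ℂ) :
    Matrix ι ι ℂ :=
  z₁ • M.underlying₁.A.map Complex.ofReal + z₂ • M.underlying₂.A.map Complex.ofReal

/-- The vector `z₁ b₁ + z₂ b₂` of the underlying additive method. -/
noncomputable def stabVector {ι : Type} [Fintype ι] (M : NPRKMethod ι) (z₁ z₂ : ℂ) : ι → ℂ :=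
  fun i => z₁ * (M.underlying₁.b i : ℂ) + z₂ * (M.underlying₂.b i : ℂ)

/-- Numerator `det (I - (z₁ A₁ + z₂ A₂) + e (z₁ b₁ + z₂ b₂)ᵀ)` of the linear stability function,
where `e` is the all-ones vector. -/
noncomputable def stabNum {ι : Type} [Fintype ι] [DecidableEq ι] (M : NPRKMethod ι)
    (z₁ z₂ : ℂ) : ℂ :=
  (1 - M.stabMatrix z₁ z₂ + Matrix.vecMulVec (fun _ => 1) (M.stabVector z₁ z₂)).det

/-- Denominator `det (I - z₁ A₁ - z₂ A₂)` of the linear stability function. -/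
noncomputable def stabDen {ι : Type} [Fintype ι] [DecidableEq ι] (M : NPRKMethod ι)
    (z₁ z₂ : ℂ) : ℂ :=
  (1 - M.stabMatrix z₁ z₂).det

/-- The linear stability function for the test equation `y' = λ₁ y + λ₂ y`. -/
noncomputable def stabFun {ι : Type} [Fintype ι] [DecidableEq ι] (M : NPRKMethod ι)
    (z₁ z₂ : ℂ) : ℂ :=
  M.stabNum z₁ z₂ / M.stabDen z₁ z₂

/-- L-stability in the stiff `z₁` limit: for every fixed `z₂`, `R(z₁, z₂)` is well defined for large
`|z₁|` and tends to `0` as `|z₁| → ∞`. -/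
def IsLStableZ₁ {ι : Type} [Fintype ι] [DecidableEq ι] (M : NPRKMethod ι) : Prop :=
  ∀ z₂ : ℂ, (∀ᶠ z₁ in Bornology.cobounded ℂ, M.stabDen z₁ z₂ ≠ 0) ∧
    Tendsto (fun z₁ => M.stabFun z₁ z₂) (Bornology.cobounded ℂ) (𝓝 0)

/-- Stiff accuracy with final stage `f`: the output weights are the coefficients of the final stage,
so that the new value equals `Y f`. -/
def IsStifflyAccurate {ι : Type} (M : NPRKMethod ι) (f : ι) : Prop := ∀ j k, M.b j k = M.a f j k

end NPRKMethod

/-- The second-order implicitly wrapped method built on an explicit method `E` with `n = m + 1`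
stages and with both implicit coefficients equal to `γ`; it has `s = n + 2` stages.
In the usual numbering `1, …, s`, stage `1` is `Sum.inl 0`, stage `2` (implicit) is `Sum.inr 0`,
stage `j + 2`, for `1 ≤ j < n`, is `Sum.inl j`, and stage `s` (implicit, final) is `Sum.inr 1`. -/
noncomputable def implicitlyWrapped₂ {m : ℕ} (E : RKMethod (Fin (m + 1))) (γ : ℝ) :
    NPRKMethod (Fin (m + 1) ⊕ Fin 2) :=
  let a : Fin (m + 1) ⊕ Fin 2 → Fin (m + 1) ⊕ Fin 2 → Fin (m + 1) ⊕ Fin 2 → ℝ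
    | .inl i, .inr 0, .inl k => E.A i k
    | .inr 0, .inr 0, .inl k => if k = 0 then γ else 0
    | .inr 1, .inr 0, .inl k => E.b k - if k = Fin.last m then γ else 0
    | .inr 1, .inr 1, .inl k => if k = Fin.last m then γ else 0
    | _, _, _ => 0
  { a := a, b := a (.inr 1) }

/-- The three-stage stiffly accurate SDIRK method with diagonal coefficient `lam`. -/
noncomputable def sdirk₃ (lam : ℝ) : RKMethod (Fin 3) where
  A := !![lam, 0, 0;
          (1 - lam) / 2, lam, 0;
          (-6 * lam ^ 2 + 16 * lam - 1) / 4, (6 * lam ^ 2 - 20 * lam + 5) / 4, lam]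
  b := ![(-6 * lam ^ 2 + 16 * lam - 1) / 4, (6 * lam ^ 2 - 20 * lam + 5) / 4, lam]

/-- The coefficient `a_{3,2,2}` of the third-order methods, for `w = 1` or `w = 2`. -/
noncomputable def coupling₃₂₂ (lam : ℝ) (w : ℕ) : ℝ :=
  if w = 1 then (2 - 6 * lam) / (18 * lam ^ 3 - 60 * lam ^ 2 + 15 * lam)
  else (2 - 6 * lam) / (18 * lam ^ 3 - 60 * lam ^ 2 + 15 * lam) - lam

/-- The coefficient `a_{n+2,3,n+1}` of the first third-order method (`n` the number of stages of
the explicit method `E`). -/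
noncomputable def couplingExpl {m : ℕ} (lam : ℝ) (E : RKMethod (Fin (m + 2))) : ℝ :=
  let c₁ := (sdirk₃ lam).c
  (1 - 3 * c₁ 0) / (6 * E.b (Fin.last (m + 1)) * (c₁ 1 - c₁ 0))

/-- The coefficient `a_{s,3,1}` of the first third-order method. -/
noncomputable def couplingOut {m : ℕ} (lam : ℝ) (E : RKMethod (Fin (m + 2))) : ℝ :=
  let a₁ := (sdirk₃ lam).A
  let c₁ := (sdirk₃ lam).c
  let cn := E.c (Fin.last (m + 1))
  (1 / 3 - a₁ 2 2 * cn + c₁ 0 * (a₁ 2 2 * cn - 1 / 2) - a₁ 2 1 * (c₁ 1 - c₁ 0) * cn) /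
    ((c₁ 0 - c₁ 1) * cn)

/-- The first third-order implicitly wrapped method built on an explicit method `E` with
`n = m + 2` stages; it has `s = n + 3` stages.
In the usual numbering `1, …, s`, stage `1` is `Sum.inl 0`, stages `2` and `3` (implicit) are
`Sum.inr 0` and `Sum.inr 1`, stage `j + 3`, for `1 ≤ j < n`, is `Sum.inl j`, and stage `s` (implicit,
final) is `Sum.inr 2`. Stage `s - 2 = n + 1` is `Sum.inl (Fin.last m).castSucc`. -/
noncomputable def implicitlyWrapped₃ {m : ℕ} (lam : ℝ) (w : ℕ) (E : RKMethod (Fin (m + 2))) :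
    NPRKMethod (Fin (m + 2) ⊕ Fin 3) :=
  let a₁ := (sdirk₃ lam).A
  let a322 := coupling₃₂₂ lam w
  let η := couplingExpl lam E
  let as31 := couplingOut lam E
  let as3l := a₁ 2 1 - as31
  let z : Fin (m + 2) := Fin.last (m + 1)
  let a : Fin (m + 2) ⊕ Fin 3 → Fin (m + 2) ⊕ Fin 3 → Fin (m + 2) ⊕ Fin 3 → ℝ
    -- stage 2
    | .inr 0, .inr 0, .inl k => if k = 0 then a₁ 0 0 else 0
    -- stage 3
    | .inr 1, .inr 0, .inl k => if k = 0 then a₁ 1 0 - a322 else 0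
    | .inr 1, .inr 0, .inr 0 => a322
    | .inr 1, .inr 1, .inl k => if k = 0 ∧ w = 1 then a₁ 1 1 else 0
    | .inr 1, .inr 1, .inr 0 => if w = 2 then a₁ 1 1 else 0
    -- stages 1, 4, …, s - 1
    | .inl i, .inr 0, .inl k => E.A i k - if i = z ∧ k = (Fin.last m).castSucc then η else 0
    | .inl i, .inr 1, .inl k => if i = z ∧ k = (Fin.last m).castSucc then η else 0
    -- stage s
    | .inr 2, .inr 0, .inl k =>
        E.b k - (if k = 0 then as31 else 0) - (if k = z then as3l + a₁ 2 2 else 0)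
    | .inr 2, .inr 1, .inl k => (if k = 0 then as31 else 0) + (if k = z then as3l else 0)
    | .inr 2, .inr 2, .inl k => if k = z then a₁ 2 2 else 0
    | _, _, _ => 0
  { a := a, b := a (.inr 2) }

/-- The coefficient `δ` of the second third-order method. -/
noncomputable def couplingDelta (lam : ℝ) : ℝ := 2 * (3 * lam - 1) / (3 * (lam - 1))

/-- The constant `X₁` of the second third-order method. -/
noncomputable def couplingX₁ {m : ℕ} (lam : ℝ) (E : RKMethod (Fin (m + 2))) : ℝ :=
  (sdirk₃ lam).A 2 1 - couplingDelta lam * (1 - E.b 0 - E.b (Fin.last (m + 1)))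

/-- The coefficient `a_{s,3,1}` of the second third-order method. -/
noncomputable def couplingOut' {m : ℕ} (lam : ℝ) (E : RKMethod (Fin (m + 2))) : ℝ :=
  let a₁ := (sdirk₃ lam).A
  let c₁ := (sdirk₃ lam).c
  let bn := E.b (Fin.last (m + 1))
  let cn := E.c (Fin.last (m + 1))
  let δ := couplingDelta lam
  let X₁ := couplingX₁ lam E
  let X₃ := bn - X₁
  let X₄ := 1 / 2 - bn * cn
  let N₁ := (1 - δ) * X₄ + cn * (X₃ - a₁ 2 2)
  let N₂ := δ * X₄ + cn * X₁
  (1 / 3 - a₁ 2 2 * cn - c₁ 0 * N₁ - c₁ 1 * N₂) / ((c₁ 0 - c₁ 1) * cn)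

/-- The second third-order implicitly wrapped method built on an explicit method `E` with
`n = m + 2` stages. The stages are numbered as in `implicitlyWrapped₃`. -/
noncomputable def implicitlyWrapped₃' {m : ℕ} (lam : ℝ) (w : ℕ) (E : RKMethod (Fin (m + 2))) :
    NPRKMethod (Fin (m + 2) ⊕ Fin 3) :=
  let a₁ := (sdirk₃ lam).A
  let a322 := coupling₃₂₂ lam w
  let δ := couplingDelta lam
  let as31 := couplingOut' lam E
  let as3l := a₁ 2 1 - as31 - δ * (1 - E.b 0 - E.b (Fin.last (m + 1)))
  let z : Fin (m + 2) := Fin.last (m + 1)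
  let a : Fin (m + 2) ⊕ Fin 3 → Fin (m + 2) ⊕ Fin 3 → Fin (m + 2) ⊕ Fin 3 → ℝ
    -- stage 2
    | .inr 0, .inr 0, .inl k => if k = 0 then a₁ 0 0 else 0
    -- stage 3
    | .inr 1, .inr 0, .inl k => if k = 0 then a₁ 1 0 - a322 else 0
    | .inr 1, .inr 0, .inr 0 => a322
    | .inr 1, .inr 1, .inl k => if k = 0 ∧ w = 1 then a₁ 1 1 else 0
    | .inr 1, .inr 1, .inr 0 => if w = 2 then a₁ 1 1 else 0
    -- stages 1, 4, …, s - 1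
    | .inl i, .inr 0, .inl k => E.A i k * (1 - δ)
    | .inl i, .inr 1, .inl k => E.A i k * δ
    -- stage s
    | .inr 2, .inr 0, .inl k =>
        if k = 0 then E.b 0 - as31
        else if k = z then E.b z - as3l - a₁ 2 2
        else E.b k * (1 - δ)
    | .inr 2, .inr 1, .inl k =>
        if k = 0 then as31 else if k = z then as3l else E.b k * δ
    | .inr 2, .inr 2, .inl k => if k = z then a₁ 2 2 else 0
    | _, _, _ => 0
  { a := a, b := a (.inr 2) }

/-!
The order of a nonlinearly partitioned method is governed by finitely many polynomial conditions on
its coefficients. Expanding `F (Y j) (Y k)` around `(y₀, y₀)` to second order and inserting the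
stage equations into themselves gives an expansion of the numerical step in the elementary differentials
of `F`; the exact solution has an expansion in the same differentials, obtained by integrating
`y' = F y y`. Matching coefficients gives three conditions for order two and ten for order three,
and these suffice (`NPRKMethod.SecondOrderConditions.hasOrder`,
`NPRKMethod.ThirdOrderConditions.hasOrder`). All estimates are uniform over the solutions of the
stage equations, as they are stated along the filter `NPRKMethod.stageFilter` of pairs (step size,
stage values). The stages themselves come from a contraction.

Conversely, the hypothesis on the explicit method `E` is only used through its classical order
conditions, which are read off from one family of polynomial test systems
(`RKMethod.HasOrder.testField_bound`).

Summing the weights of a wrapped method over the second argument leaves the weights of an implicit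
method (an SDIRK method in third order), and summing over the first argument leaves those of `E`. So
the conditions that involve only one argument hold because they hold for these two methods; the
coupling coefficients are chosen such that the mixed conditions hold as well
(`wrapped₃_thirdOrderConditions`, a common form of both third-order methods).

For L-stability, a stiffly accurate method has `R = x f`, where `x` solves
`(I - z₁ A₁ - z₂ A₂) x = e` and `f` is the final stage. In a suitable ordering of the stages this
system is lower triangular, its diagonal entries are `1` or `1 - z₁ a` with `a ≠ 0`, and `z₁` only
multiplies components of the second kind. Forward substitution shows that these components are
`O(1 / z₁)` and all others are `O(1)` (`NPRKMethod.IsStiffTriangular.isBigO_stages`); the final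
stage is of the second kind.
-/

open Asymptotics

/-! ### Taylor expansion with asymptotic remainder -/

section Taylor

variable {V W : Type*} [NormedAddCommGroup V] [NormedSpace ℝ V]
  [NormedAddCommGroup W] [NormedSpace ℝ W]

/-- By the mean value inequality, a function that vanishes at `x₀` and whose derivative is
`O(‖x - x₀‖ ^ n)` is `O(‖x - x₀‖ ^ (n + 1))`. Both the Taylor formulas and the expansion of the
exact solution rest on this. -/
theorem isBigO_pow_succ_of_hasFDerivAt {g : V → W} {g' : V → V →L[ℝ] W} {x₀ : V} {n : ℕ}
    (hg : ∀ᶠ x in 𝓝 x₀, HasFDerivAt g (g' x) x)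
    (hg' : g' =O[𝓝 x₀] fun x => ‖x - x₀‖ ^ n) (h0 : g x₀ = 0) :
    g =O[𝓝 x₀] fun x => ‖x - x₀‖ ^ (n + 1) := by
  obtain ⟨C, hC⟩ := hg'.bound
  obtain ⟨ε, hε, hball⟩ := Metric.eventually_nhds_iff_ball.1 (hg.and hC)
  refine IsBigO.of_bound C ?_
  filter_upwards [Metric.ball_mem_nhds x₀ hε] with x hx
  have hsub : Metric.closedBall x₀ ‖x - x₀‖ ⊆ Metric.ball x₀ ε :=
    Metric.closedBall_subset_ball (by simpa [dist_eq_norm] using hx)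
  -- the constant of an `O` bound need not be nonnegative, unless the bound is used off `x₀`
  have hC0 : 0 ≤ C ∨ x = x₀ := by
    by_cases hxx : x = x₀
    · exact Or.inr hxx
    · left
      have h1 := (norm_nonneg _).trans (hball x hx).2
      have h2 : 0 < ‖x - x₀‖ ^ n := pow_pos (norm_pos_iff.2 (sub_ne_zero.2 hxx)) n
      rw [norm_pow, norm_norm] at h1
      exact nonneg_of_mul_nonneg_left h1 h2
  rcases hC0 with hC0 | rfl
  · have key := (convex_closedBall x₀ ‖x - x₀‖).norm_image_sub_le_of_norm_hasFDerivWithin_le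
      (f := g) (f' := g') (C := C * ‖x - x₀‖ ^ n) (x := x₀) (y := x)
      (fun z hz => (hball z (hsub hz)).1.hasFDerivWithinAt)
      (fun z hz => by
        refine (hball z (hsub hz)).2.trans ?_
        rw [norm_pow, norm_norm]
        have : ‖z - x₀‖ ≤ ‖x - x₀‖ := by simpa [dist_eq_norm] using hz
        gcongr)
      (by simp) (by simp [dist_eq_norm])
    rw [h0, sub_zero] at key
    rw [norm_pow, norm_norm, pow_succ, ← mul_assoc]
    exact key
  · simp [h0]

/-- Integrating an asymptotic bound on the derivative gains one power of `t`. -/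
theorem isBigO_pow_succ_of_hasDerivAt {g g' : ℝ → W} {n : ℕ}
    (hg : ∀ᶠ t in 𝓝 0, HasDerivAt g (g' t) t)
    (hg' : g' =O[𝓝 0] fun t => t ^ n) (h0 : g 0 = 0) :
    g =O[𝓝 0] fun t => t ^ (n + 1) := by
  have key := isBigO_pow_succ_of_hasFDerivAt (g := g) (x₀ := (0 : ℝ)) (n := n)
    (g' := fun t => ContinuousLinearMap.smulRight (1 : ℝ →L[ℝ] ℝ) (g' t))
    (hg.mono fun t ht => ht.hasFDerivAt) ?_ h0
  · refine key.trans ?_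
    simp only [sub_zero, ← norm_pow]
    exact (isBigO_refl _ _).norm_left
  · refine IsBigO.trans (IsBigO.of_norm_left ?_) (hg'.trans ?_)
    · simpa using isBigO_refl _ _
    · simp only [sub_zero, ← norm_pow]
      exact (isBigO_refl _ _).norm_right

theorem ContDiff.taylor_one_isBigO {G : V → W} (hG : ContDiff ℝ ∞ G) (x₀ : V) :
    (fun x => G x - G x₀ - fderiv ℝ G x₀ (x - x₀)) =O[𝓝 x₀] fun x => ‖x - x₀‖ ^ 2 := by
  have hd : Differentiable ℝ G := hG.differentiable (by simp)
  have hG' : ContDiff ℝ ∞ (fderiv ℝ G) := hG.fderiv_right (by simp)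
  refine isBigO_pow_succ_of_hasFDerivAt (n := 1)
    (g' := fun x => fderiv ℝ G x - fderiv ℝ G x₀) ?_ ?_ (by simp)
  · refine Eventually.of_forall fun x => ?_
    refine ((hd x).hasFDerivAt.sub_const _).sub ?_
    exact ((fderiv ℝ G x₀).hasFDerivAt.comp x ((hasFDerivAt_id x).sub_const x₀)).congr_fderiv
      (ContinuousLinearMap.comp_id _)
  · simpa using ((hG'.differentiable (by simp)) x₀).isBigO_sub.norm_right

theorem ContDiff.taylor_two_isBigO {G : V → W} (hG : ContDiff ℝ ∞ G) (x₀ : V) :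
    (fun x => G x - G x₀ - fderiv ℝ G x₀ (x - x₀)
      - (1 / 2 : ℝ) • fderiv ℝ (fderiv ℝ G) x₀ (x - x₀) (x - x₀))
      =O[𝓝 x₀] fun x => ‖x - x₀‖ ^ 3 := by
  have hd : Differentiable ℝ G := hG.differentiable (by simp)
  have hG' : ContDiff ℝ ∞ (fderiv ℝ G) := hG.fderiv_right (by simp)
  have hsymm : IsSymmSndFDerivAt ℝ G x₀ := hG.contDiffAt.isSymmSndFDerivAt
    (by simpa using WithTop.coe_le_coe.2 (le_top : (2 : ℕ∞) ≤ ⊤))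
  refine isBigO_pow_succ_of_hasFDerivAt (n := 2)
    (g' := fun x => fderiv ℝ G x - fderiv ℝ G x₀ - fderiv ℝ (fderiv ℝ G) x₀ (x - x₀)) ?_
    (hG'.taylor_one_isBigO x₀) (by simp)
  refine Eventually.of_forall fun x => ?_
  have hs : HasFDerivAt (fun x => x - x₀) (ContinuousLinearMap.id ℝ V) x :=
    (hasFDerivAt_id x).sub_const x₀
  refine (((hd x).hasFDerivAt.sub_const _).sub ?_).sub ?_
  · exact ((fderiv ℝ G x₀).hasFDerivAt.comp x hs).congr_fderiv (ContinuousLinearMap.comp_id _)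
  · have h2 := (((fderiv ℝ (fderiv ℝ G) x₀).hasFDerivAt.comp x hs).clm_apply hs).const_smul
      (1 / 2 : ℝ)
    refine h2.congr_fderiv ?_
    ext v
    have := hsymm v (x - x₀)
    simp only [Function.comp_apply, ContinuousLinearMap.comp_id, smul_apply,
      add_apply, ContinuousLinearMap.flip_apply] at *
    rw [this, ← two_smul ℝ, smul_smul]
    norm_num

variable {α : Type*} {l : Filter α} {h : α → ℝ} {w : α → V}

/-- First-order expansion of `G` along an argument known up to `O(h ^ 2)`. -/
theorem ContDiff.expansion_one {G : V → W} (hG : ContDiff ℝ ∞ G) {w₀ v₁ : V}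
    (hh : Tendsto h l (𝓝 0)) (hw : (fun a => w a - w₀ - h a • v₁) =O[l] fun a => h a ^ 2) :
    (fun a => G (w a) - G w₀ - h a • fderiv ℝ G w₀ v₁) =O[l] fun a => h a ^ 2 := by
  have hh2 : (fun a => h a ^ 2) =O[l] h := by
    simpa [pow_two] using (hh.isBigO_one ℝ).mul (isBigO_refl h l)
  have hδ : (fun a => w a - w₀) =O[l] h := by
    have h1 : (fun a => h a • v₁) =O[l] h := by
      simpa using (isBigO_refl h l).smul (isBigO_const_const v₁ (one_ne_zero (α := ℝ)) l)
    simpa using (hw.trans hh2).add h1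
  have hlim : Tendsto w l (𝓝 w₀) := tendsto_sub_nhds_zero_iff.1 (hδ.trans_tendsto hh)
  have h2 : (fun a => fderiv ℝ G w₀ (w a - w₀ - h a • v₁)) =O[l] fun a => h a ^ 2 :=
    ((fderiv ℝ G w₀).isBigO_comp _ _).trans hw
  refine ((((hG.taylor_one_isBigO w₀).comp_tendsto hlim).trans
    ((hδ.norm_left).pow 2)).add h2).congr_left fun a => ?_
  simp

/-- Second-order expansion of `G` along an argument known up to `O(h ^ 3)`. -/
theorem ContDiff.expansion_two {G : V → W} (hG : ContDiff ℝ ∞ G) {w₀ v₁ v₂ : V}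
    (hh : Tendsto h l (𝓝 0))
    (hw : (fun a => w a - w₀ - h a • v₁ - h a ^ 2 • v₂) =O[l] fun a => h a ^ 3) :
    (fun a => G (w a) - G w₀ - h a • fderiv ℝ G w₀ v₁ - h a ^ 2 • (fderiv ℝ G w₀ v₂
      + (1 / 2 : ℝ) • fderiv ℝ (fderiv ℝ G) w₀ v₁ v₁)) =O[l] fun a => h a ^ 3 := by
  have hh2 : (fun a => h a ^ 2) =O[l] h := by
    simpa [pow_two] using (hh.isBigO_one ℝ).mul (isBigO_refl h l)
  have hh3 : (fun a => h a ^ 3) =O[l] fun a => h a ^ 2 := by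
    exact ((isBigO_refl (fun a => h a ^ 2) l).mul (hh.isBigO_one ℝ)).congr
      (fun a => by ring) (fun a => by ring)
  have hv1 : (fun a => h a • v₁) =O[l] h := by
    simpa using (isBigO_refl h l).smul (isBigO_const_const v₁ (one_ne_zero (α := ℝ)) l)
  have hv2 : (fun a => h a ^ 2 • v₂) =O[l] fun a => h a ^ 2 := by
    simpa using (isBigO_refl (fun a => h a ^ 2) l).smul
      (isBigO_const_const v₂ (one_ne_zero (α := ℝ)) l)
  have hδ₂ : (fun a => w a - w₀ - h a • v₁) =O[l] fun a => h a ^ 2 := by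
    simpa using (hw.trans hh3).add hv2
  have hδ : (fun a => w a - w₀) =O[l] h := by
    simpa using (hδ₂.trans hh2).add hv1
  have hlim : Tendsto w l (𝓝 w₀) := tendsto_sub_nhds_zero_iff.1 (hδ.trans_tendsto hh)
  have h2 : (fun a => fderiv ℝ G w₀ (w a - w₀ - h a • v₁ - h a ^ 2 • v₂)) =O[l]
      fun a => h a ^ 3 := ((fderiv ℝ G w₀).isBigO_comp _ _).trans hw
  set B := fderiv ℝ (fderiv ℝ G) w₀
  have hB : ∀ {u v : α → V} {m n : ℕ}, u =O[l] (fun a => h a ^ m) → v =O[l] (fun a => h a ^ n) →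
      (fun a => (1 / 2 : ℝ) • B (u a) (v a)) =O[l] fun a => h a ^ (m + n) := by
    intro u v m n hu hv
    refine IsBigO.const_smul_left ?_ _
    simp only [pow_add]
    refine IsBigO.trans (IsBigO.of_bound ‖B‖ (Eventually.of_forall fun a => ?_))
      (hu.norm_left.mul hv.norm_left)
    simpa [mul_assoc] using B.le_opNorm₂ (u a) (v a)
  have h3 := hB (m := 2) (n := 1) hδ₂ (by simpa using hδ)
  have h4 := hB (m := 1) (n := 2) (by simpa using hv1) hδ₂
  refine (((((hG.taylor_two_isBigO w₀).comp_tendsto hlim).trans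
    ((hδ.norm_left).pow 3)).add h2).add (h3.add h4)).congr_left fun a => ?_
  simp only [Function.comp_apply, map_sub, map_smul, sub_apply,
    smul_apply]
  module

end Taylor

/-! ### Existence and asymptotics of the stages -/

section FixedPoint

/-- For small `h` the map `x ↦ x₀ + h • Ψ x` is a contraction of the unit ball around `x₀`. -/
theorem ContDiff.exists_eq_add_smul {V : Type*} [NormedAddCommGroup V] [NormedSpace ℝ V]
    [ProperSpace V] {Ψ : V → V} (hΨ : ContDiff ℝ ∞ Ψ) (x₀ : V) :
    ∃ h₀ > 0, ∀ h : ℝ, 0 < h → h ≤ h₀ → ∃ x, x = x₀ + h • Ψ x ∧ ‖x - x₀‖ ≤ 1 := by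
  have hK : IsCompact (Metric.closedBall x₀ 1) := isCompact_closedBall x₀ 1
  obtain ⟨C₁, hC₁⟩ := hK.exists_bound_of_continuousOn hΨ.continuous.continuousOn
  obtain ⟨C₂, hC₂⟩ := hK.exists_bound_of_continuousOn
    (hΨ.continuous_fderiv (by simp)).continuousOn
  have hC₁0 : 0 ≤ C₁ := (norm_nonneg _).trans (hC₁ x₀ (by simp))
  have hC₂0 : 0 ≤ C₂ := (norm_nonneg _).trans (hC₂ x₀ (by simp))
  refine ⟨1 / (2 * (C₁ + C₂ + 1)), by positivity, fun h hpos hh => ?_⟩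
  have hh' : h * (2 * (C₁ + C₂ + 1)) ≤ 1 := by
    rwa [le_div_iff₀ (by positivity)] at hh
  have hmaps : Set.MapsTo (fun x => x₀ + h • Ψ x) (Metric.closedBall x₀ 1)
      (Metric.closedBall x₀ 1) := by
    intro x hx
    rw [mem_closedBall_iff_norm, add_sub_cancel_left, norm_smul, Real.norm_of_nonneg hpos.le]
    nlinarith [mul_le_mul_of_nonneg_left (hC₁ x hx) hpos.le, mul_nonneg hpos.le hC₂0]
  have hcontr : ContractingWith (1 / 2) (hmaps.restrict _ _ _) := by
    refine ⟨by rw [← NNReal.coe_lt_coe]; norm_num, LipschitzWith.of_dist_le_mul fun x y => ?_⟩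
    have := (convex_closedBall x₀ 1).norm_image_sub_le_of_norm_fderiv_le
      (f := Ψ) (𝕜 := ℝ) (fun z _ => hΨ.differentiable (by simp) z) hC₂ y.2 x.2
    rw [Subtype.dist_eq, Subtype.dist_eq, dist_eq_norm, dist_eq_norm]
    simp only [Set.MapsTo.val_restrict_apply, add_sub_add_left_eq_sub, ← smul_sub, norm_smul,
      Real.norm_of_nonneg hpos.le]
    have h2 : h * C₂ ≤ 1 / 2 := by nlinarith [mul_nonneg hpos.le hC₁0]
    calc h * ‖Ψ x - Ψ y‖ ≤ h * (C₂ * ‖(x : V) - y‖) := by gcongr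
      _ = h * C₂ * ‖(x : V) - y‖ := by ring
      _ ≤ 1 / 2 * ‖(x : V) - y‖ := by gcongr
      _ = _ := by norm_num
  obtain ⟨x, hx, hfix, -⟩ := hcontr.exists_fixedPoint' Metric.isClosed_closedBall.isComplete hmaps
    (x := x₀) (by simp) (edist_ne_top _ _)
  exact ⟨x, hfix.symm, by simpa [dist_eq_norm] using hx⟩

end FixedPoint

namespace NPRKMethod

variable {ι : Type} [Fintype ι]

/-- The abscissae `∑ j, ∑ k, a i j k`. -/
def c (M : NPRKMethod ι) (i : ι) : ℝ := ∑ j, ∑ k, M.a i j k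

/-- The conditions for order two on the coefficients of an NPRK method. -/
structure SecondOrderConditions (M : NPRKMethod ι) : Prop where
  sum_b : ∑ i, ∑ j, M.b i j = 1
  sum_b_c₁ : ∑ i, ∑ j, M.b i j * M.c i = 1 / 2
  sum_b_c₂ : ∑ i, ∑ j, M.b i j * M.c j = 1 / 2

/-- The conditions for order three on the coefficients of an NPRK method. The last four are indexed
by the position (first or second argument) in which each of two nested evaluations is inserted. -/
structure ThirdOrderConditions (M : NPRKMethod ι) : Prop extends SecondOrderConditions M where
  sum_b_c₁₁ : ∑ i, ∑ j, M.b i j * M.c i ^ 2 = 1 / 3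
  sum_b_c₁₂ : ∑ i, ∑ j, M.b i j * (M.c i * M.c j) = 1 / 3
  sum_b_c₂₂ : ∑ i, ∑ j, M.b i j * M.c j ^ 2 = 1 / 3
  sum_b_a₁_c₁ : ∑ i, ∑ j, M.b i j * ∑ k, ∑ l, M.a i k l * M.c k = 1 / 6
  sum_b_a₁_c₂ : ∑ i, ∑ j, M.b i j * ∑ k, ∑ l, M.a i k l * M.c l = 1 / 6
  sum_b_a₂_c₁ : ∑ i, ∑ j, M.b i j * ∑ k, ∑ l, M.a j k l * M.c k = 1 / 6
  sum_b_a₂_c₂ : ∑ i, ∑ j, M.b i j * ∑ k, ∑ l, M.a j k l * M.c l = 1 / 6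

variable {d : ℕ} {M : NPRKMethod ι} {F : (Fin d → ℝ) → (Fin d → ℝ) → (Fin d → ℝ)}
  {y₀ : Fin d → ℝ}

theorem exists_isStages (M : NPRKMethod ι) (hF : ContDiff ℝ ∞ (Function.uncurry F))
    (y₀ : Fin d → ℝ) :
    ∃ h₀ > 0, ∀ h : ℝ, 0 < h → h ≤ h₀ →
      ∃ Y : ι → Fin d → ℝ, M.IsStages F y₀ h Y ∧ ∀ i, ‖Y i - y₀‖ ≤ 1 := by
  have hΨ : ContDiff ℝ ∞ fun (Y : ι → Fin d → ℝ) (i : ι) =>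
      ∑ j, ∑ k, M.a i j k • F (Y j) (Y k) := by
    refine contDiff_pi.2 fun i => ContDiff.sum fun j _ => ContDiff.sum fun k _ => ?_
    have hjk : ContDiff ℝ ∞ fun Y : ι → Fin d → ℝ => (Y j, Y k) :=
      (contDiff_apply ℝ (Fin d → ℝ) j).prodMk (contDiff_apply ℝ (Fin d → ℝ) k)
    exact (hF.comp hjk).const_smul (M.a i j k)
  obtain ⟨h₀, h₀pos, H⟩ := hΨ.exists_eq_add_smul fun _ => y₀
  refine ⟨h₀, h₀pos, fun h hpos hh => ?_⟩
  obtain ⟨Y, hY, hn⟩ := H h hpos hh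
  exact ⟨Y, fun i => congrFun hY i, fun i => (norm_le_pi_norm (Y - fun _ => y₀) i).trans hn⟩

/-- The filter of pairs (step size, stage values) in which the step size tends to zero and the stage
values solve the stage equations in the unit ball around `y₀`. -/
def stageFilter (M : NPRKMethod ι) (F : (Fin d → ℝ) → (Fin d → ℝ) → (Fin d → ℝ))
    (y₀ : Fin d → ℝ) : Filter (ℝ × (ι → Fin d → ℝ)) :=
  comap Prod.fst (𝓝 0) ⊓ 𝓟 {q | M.IsStages F y₀ q.1 q.2 ∧ ∀ i, ‖q.2 i - y₀‖ ≤ 1}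

theorem hasOrder_of_isBigO {p : ℕ}
    (H : ∀ (d : ℕ) (F : (Fin d → ℝ) → (Fin d → ℝ) → (Fin d → ℝ)),
      ContDiff ℝ ∞ (Function.uncurry F) →
      ∀ y : ℝ → Fin d → ℝ, (∀ᶠ t in 𝓝 0, HasDerivAt y (F (y t) (y t)) t) →
        (fun q => M.output F (y 0) q.1 q.2 - y q.1) =O[M.stageFilter F (y 0)]
          fun q => q.1 ^ (p + 1)) : M.HasOrder p := by
  intro d F hF y hy
  obtain ⟨h₁, h₁pos, hex⟩ := M.exists_isStages hF (y 0)
  obtain ⟨C, hC⟩ := (H d F hF y hy).bound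
  rw [stageFilter, eventually_inf_principal, eventually_comap] at hC
  obtain ⟨h₂, h₂pos, hball⟩ := Metric.eventually_nhds_iff_ball.1 hC
  refine ⟨1, one_pos, min h₁ (h₂ / 2), by positivity, C, fun h hpos hh => ⟨?_, ?_⟩⟩
  · exact hex h hpos (hh.trans (min_le_left _ _))
  · intro Y hY hY1
    have hlt : h ∈ Metric.ball 0 h₂ := by
      rw [mem_ball_zero_iff, Real.norm_of_nonneg hpos.le]
      linarith [hh.trans (min_le_right _ _)]
    have := hball h hlt (h, Y) rfl ⟨hY, hY1⟩
    rwa [norm_pow, Real.norm_of_nonneg hpos.le] at this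

theorem tendsto_fst_stageFilter : Tendsto Prod.fst (M.stageFilter F y₀) (𝓝 0) :=
  tendsto_comap.mono_left inf_le_left

theorem eventually_stageFilter :
    ∀ᶠ q in M.stageFilter F y₀, M.IsStages F y₀ q.1 q.2 ∧ ∀ i, ‖q.2 i - y₀‖ ≤ 1 :=
  mem_inf_of_right (mem_principal_self _)

/-- One insertion into the stage equations gains a power of `h`. -/
theorem smul_sum_isBigO {α : Type*} {l : Filter α} {h : α → ℝ} {W : Type*} [NormedAddCommGroup W]
    [NormedSpace ℝ W] (β : ι → ι → ℝ) {f φ : ι → ι → α → W} {n : ℕ}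
    (H : ∀ j k, (fun a => f j k a - φ j k a) =O[l] fun a => h a ^ n) :
    (fun a => h a • ∑ j, ∑ k, β j k • f j k a - h a • ∑ j, ∑ k, β j k • φ j k a) =O[l]
      fun a => h a ^ (n + 1) := by
  have h1 : (fun a => ∑ j, ∑ k, β j k • (f j k a - φ j k a)) =O[l] fun a => h a ^ n :=
    IsBigO.fun_sum fun j _ => IsBigO.fun_sum fun k _ => (H j k).const_smul_left _
  refine ((isBigO_refl h l).smul h1).congr (fun a => ?_) (fun a => ?_)
  · simp only [smul_sub, Finset.sum_sub_distrib]
  · rw [smul_eq_mul, pow_succ']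

end NPRKMethod

/-! ### Elementary differentials and sufficiency of the order conditions -/

section Elementary

variable {d : ℕ} (F : (Fin d → ℝ) → (Fin d → ℝ) → (Fin d → ℝ)) (y₀ : Fin d → ℝ)

/-- The partial derivative of `F` in its first argument at `(y₀, y₀)`. -/
noncomputable def partialFDeriv₁ (u : Fin d → ℝ) : Fin d → ℝ :=
  fderiv ℝ (Function.uncurry F) (y₀, y₀) (u, 0)

/-- The partial derivative of `F` in its second argument at `(y₀, y₀)`. -/
noncomputable def partialFDeriv₂ (u : Fin d → ℝ) : Fin d → ℝ :=
  fderiv ℝ (Function.uncurry F) (y₀, y₀) (0, u)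

/-- The second derivative of `F` at `(y₀, y₀)`, on two vectors of the product space. -/
noncomputable def secondFDeriv (u v : (Fin d → ℝ) × (Fin d → ℝ)) : Fin d → ℝ :=
  fderiv ℝ (fderiv ℝ (Function.uncurry F)) (y₀, y₀) u v

theorem fderiv_uncurry_apply (u v : Fin d → ℝ) :
    fderiv ℝ (Function.uncurry F) (y₀, y₀) (u, v) =
      partialFDeriv₁ F y₀ u + partialFDeriv₂ F y₀ v := by
  rw [partialFDeriv₁, partialFDeriv₂, ← map_add]
  simp

theorem partialFDeriv₁_smul (r : ℝ) (u : Fin d → ℝ) :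
    partialFDeriv₁ F y₀ (r • u) = r • partialFDeriv₁ F y₀ u := by
  rw [partialFDeriv₁, partialFDeriv₁, ← map_smul]
  simp

theorem partialFDeriv₂_smul (r : ℝ) (u : Fin d → ℝ) :
    partialFDeriv₂ F y₀ (r • u) = r • partialFDeriv₂ F y₀ u := by
  rw [partialFDeriv₂, partialFDeriv₂, ← map_smul]
  simp

theorem partialFDeriv₁_add (u v : Fin d → ℝ) :
    partialFDeriv₁ F y₀ (u + v) = partialFDeriv₁ F y₀ u + partialFDeriv₁ F y₀ v := by
  rw [partialFDeriv₁, partialFDeriv₁, partialFDeriv₁, ← map_add]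
  simp

theorem partialFDeriv₂_add (u v : Fin d → ℝ) :
    partialFDeriv₂ F y₀ (u + v) = partialFDeriv₂ F y₀ u + partialFDeriv₂ F y₀ v := by
  rw [partialFDeriv₂, partialFDeriv₂, partialFDeriv₂, ← map_add]
  simp

theorem fderiv_fderiv_uncurry_apply (r s : ℝ) (u : Fin d → ℝ) :
    fderiv ℝ (fderiv ℝ (Function.uncurry F)) (y₀, y₀) (r • u, s • u) (r • u, s • u) =
      r ^ 2 • secondFDeriv F y₀ (u, 0) (u, 0)
      + (r * s) • (secondFDeriv F y₀ (u, 0) (0, u) + secondFDeriv F y₀ (0, u) (u, 0))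
      + s ^ 2 • secondFDeriv F y₀ (0, u) (0, u) := by
  have h : (r • u, s • u) = r • (u, (0 : Fin d → ℝ)) + s • ((0 : Fin d → ℝ), u) := by simp
  rw [h]
  simp only [secondFDeriv, map_add, map_smul, add_apply, smul_apply]
  module

variable {F y₀}

/-- First-order expansion of `F (u, v)` when both arguments leave `y₀` along `F (y₀, y₀)`, with
relative speeds `r` and `s`. -/
theorem ContDiff.expansion_one_pair {α : Type*} {l : Filter α} {h : α → ℝ} {u v : α → Fin d → ℝ}
    (hF : ContDiff ℝ ∞ (Function.uncurry F)) (hh : Tendsto h l (𝓝 0)) {r s : ℝ}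
    (hu : (fun a => u a - y₀ - h a • r • F y₀ y₀) =O[l] fun a => h a ^ 2)
    (hv : (fun a => v a - y₀ - h a • s • F y₀ y₀) =O[l] fun a => h a ^ 2) :
    (fun a => F (u a) (v a) - (F y₀ y₀ + h a • (r • partialFDeriv₁ F y₀ (F y₀ y₀)
      + s • partialFDeriv₂ F y₀ (F y₀ y₀)))) =O[l] fun a => h a ^ 2 := by
  have := hF.expansion_one (w := fun a => (u a, v a)) (w₀ := (y₀, y₀))
    (v₁ := (r • F y₀ y₀, s • F y₀ y₀)) hh (hu.prod_left hv)
  refine this.congr_left fun a => ?_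
  rw [fderiv_uncurry_apply, partialFDeriv₁_smul, partialFDeriv₂_smul]
  simp only [Function.uncurry_apply_pair]
  abel

/-- Second-order expansion of `F (u, v)` when both arguments are known up to `O(h ^ 3)`. -/
theorem ContDiff.expansion_two_pair {α : Type*} {l : Filter α} {h : α → ℝ} {u v : α → Fin d → ℝ}
    (hF : ContDiff ℝ ∞ (Function.uncurry F)) (hh : Tendsto h l (𝓝 0)) {r s : ℝ}
    {p q : Fin d → ℝ}
    (hu : (fun a => u a - y₀ - h a • r • F y₀ y₀ - h a ^ 2 • p) =O[l] fun a => h a ^ 3)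
    (hv : (fun a => v a - y₀ - h a • s • F y₀ y₀ - h a ^ 2 • q) =O[l] fun a => h a ^ 3) :
    (fun a => F (u a) (v a) - (F y₀ y₀ + h a • (r • partialFDeriv₁ F y₀ (F y₀ y₀)
      + s • partialFDeriv₂ F y₀ (F y₀ y₀)) + h a ^ 2 • (partialFDeriv₁ F y₀ p
      + partialFDeriv₂ F y₀ q
      + (1 / 2 : ℝ) • (r ^ 2 • secondFDeriv F y₀ (F y₀ y₀, 0) (F y₀ y₀, 0)
        + (r * s) • (secondFDeriv F y₀ (F y₀ y₀, 0) (0, F y₀ y₀)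
          + secondFDeriv F y₀ (0, F y₀ y₀) (F y₀ y₀, 0))
        + s ^ 2 • secondFDeriv F y₀ (0, F y₀ y₀) (0, F y₀ y₀))))) =O[l] fun a => h a ^ 3 := by
  have := hF.expansion_two (w := fun a => (u a, v a)) (w₀ := (y₀, y₀))
    (v₁ := (r • F y₀ y₀, s • F y₀ y₀)) (v₂ := (p, q)) hh (hu.prod_left hv)
  refine this.congr_left fun a => ?_
  rw [fderiv_uncurry_apply, fderiv_uncurry_apply, partialFDeriv₁_smul, partialFDeriv₂_smul,
    fderiv_fderiv_uncurry_apply]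
  simp only [Function.uncurry_apply_pair]
  abel

end Elementary

section ExactSolution

variable {d : ℕ} {F : (Fin d → ℝ) → (Fin d → ℝ) → (Fin d → ℝ)} {y : ℝ → Fin d → ℝ}

theorem solution_expansion_one (hF : ContDiff ℝ ∞ (Function.uncurry F))
    (hy : ∀ᶠ t in 𝓝 0, HasDerivAt y (F (y t) (y t)) t) :
    (fun t => y t - y 0 - t • (1 : ℝ) • F (y 0) (y 0)) =O[𝓝 0] fun t => t ^ 2 := by
  have hy0 : DifferentiableAt ℝ y 0 := hy.self_of_nhds.differentiableAt
  have hd : DifferentiableAt ℝ (fun t => Function.uncurry F (y t, y t)) 0 :=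
    DifferentiableAt.comp (f := fun t => (y t, y t)) (0 : ℝ)
      (hF.differentiable (by simp) (y 0, y 0)) (hy0.prodMk hy0)
  refine isBigO_pow_succ_of_hasDerivAt (n := 1)
    (g' := fun t => F (y t) (y t) - F (y 0) (y 0)) (hy.mono fun t ht => ?_) ?_ (by simp)
  · refine ((ht.sub_const (y 0)).sub ((hasDerivAt_id t).smul_const _)).congr_deriv ?_
    simp
  · simpa using hd.isBigO_sub

theorem solution_expansion_two (hF : ContDiff ℝ ∞ (Function.uncurry F))
    (hy : ∀ᶠ t in 𝓝 0, HasDerivAt y (F (y t) (y t)) t) :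
    (fun t => y t - y 0 - t • (1 : ℝ) • F (y 0) (y 0) - t ^ 2 • (1 / 2 : ℝ) •
      (partialFDeriv₁ F (y 0) (F (y 0) (y 0)) + partialFDeriv₂ F (y 0) (F (y 0) (y 0))))
      =O[𝓝 0] fun t => t ^ 3 := by
  have h1 := solution_expansion_one hF hy
  refine isBigO_pow_succ_of_hasDerivAt (n := 2) (hy.mono fun t ht => ?_)
    (hF.expansion_one_pair tendsto_id h1 h1) (by simp)
  refine (((ht.sub_const (y 0)).sub ((hasDerivAt_id t).smul_const _)).sub
    ((hasDerivAt_pow 2 t).smul_const _)).congr_deriv ?_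
  simp only [id]
  module

/-- The third-order Taylor expansion of the exact solution in elementary differentials. -/
theorem solution_expansion_three (hF : ContDiff ℝ ∞ (Function.uncurry F))
    (hy : ∀ᶠ t in 𝓝 0, HasDerivAt y (F (y t) (y t)) t) :
    (fun t => y t - y 0 - t • F (y 0) (y 0) - t ^ 2 • (1 / 2 : ℝ) •
      (partialFDeriv₁ F (y 0) (F (y 0) (y 0)) + partialFDeriv₂ F (y 0) (F (y 0) (y 0)))
      - t ^ 3 • ((1 / 6 : ℝ) • (partialFDeriv₁ F (y 0) (partialFDeriv₁ F (y 0) (F (y 0) (y 0)))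
        + partialFDeriv₁ F (y 0) (partialFDeriv₂ F (y 0) (F (y 0) (y 0)))
        + partialFDeriv₂ F (y 0) (partialFDeriv₁ F (y 0) (F (y 0) (y 0)))
        + partialFDeriv₂ F (y 0) (partialFDeriv₂ F (y 0) (F (y 0) (y 0)))
        + secondFDeriv F (y 0) (F (y 0) (y 0), 0) (F (y 0) (y 0), 0)
        + (secondFDeriv F (y 0) (F (y 0) (y 0), 0) (0, F (y 0) (y 0))
          + secondFDeriv F (y 0) (0, F (y 0) (y 0)) (F (y 0) (y 0), 0))
        + secondFDeriv F (y 0) (0, F (y 0) (y 0)) (0, F (y 0) (y 0)))))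
      =O[𝓝 0] fun t => t ^ 4 := by
  have h2 := solution_expansion_two hF hy
  refine isBigO_pow_succ_of_hasDerivAt (n := 3) (hy.mono fun t ht => ?_)
    (hF.expansion_two_pair tendsto_id h2 h2) (by simp)
  refine ((((ht.sub_const (y 0)).sub ((hasDerivAt_id t).smul_const _)).sub
    ((hasDerivAt_pow 2 t).smul_const _)).sub ((hasDerivAt_pow 3 t).smul_const _)).congr_deriv ?_
  simp only [id, partialFDeriv₁_smul, partialFDeriv₂_smul, partialFDeriv₁_add, partialFDeriv₂_add]
  module

end ExactSolution

namespace NPRKMethod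

variable {ι : Type} [Fintype ι] {d : ℕ} {M : NPRKMethod ι}
  {F : (Fin d → ℝ) → (Fin d → ℝ) → (Fin d → ℝ)} {y₀ : Fin d → ℝ}

theorem stage_sub_isBigO (hF : ContDiff ℝ ∞ (Function.uncurry F)) (i : ι) :
    (fun q => q.2 i - y₀) =O[M.stageFilter F y₀] Prod.fst := by
  obtain ⟨C, hC⟩ := (isCompact_closedBall (y₀, y₀) 1).exists_bound_of_continuousOn
    hF.continuous.continuousOn
  have hb : ∀ j k, (fun q : ℝ × (ι → Fin d → ℝ) => F (q.2 j) (q.2 k) - 0)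
      =O[M.stageFilter F y₀] fun q => q.1 ^ 0 := by
    intro j k
    refine IsBigO.of_bound C ?_
    filter_upwards [eventually_stageFilter] with q hq
    have : (q.2 j, q.2 k) ∈ Metric.closedBall (y₀, y₀) 1 := by
      simpa [dist_eq_norm, Prod.dist_eq] using ⟨hq.2 j, hq.2 k⟩
    simpa using hC _ this
  refine (smul_sum_isBigO (M.a i) hb).congr' ?_ (by simp)
  filter_upwards [eventually_stageFilter] with q hq
  rw [hq.1 i]
  simp

/-- Expansion of the stages, obtained by inserting the stage equations into themselves. -/
theorem stage_expansion_one (hF : ContDiff ℝ ∞ (Function.uncurry F)) (i : ι) :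
    (fun q => q.2 i - y₀ - q.1 • M.c i • F y₀ y₀) =O[M.stageFilter F y₀]
      fun q => q.1 ^ 2 := by
  have hb : ∀ j k, (fun q : ℝ × (ι → Fin d → ℝ) => F (q.2 j) (q.2 k) - F y₀ y₀)
      =O[M.stageFilter F y₀] fun q => q.1 ^ 1 := by
    intro j k
    have hjk : (fun q : ℝ × (ι → Fin d → ℝ) => (q.2 j, q.2 k) - (y₀, y₀))
        =O[M.stageFilter F y₀] fun q => q.1 :=
      (stage_sub_isBigO hF j).prod_left (stage_sub_isBigO hF k)
    have hlim := tendsto_sub_nhds_zero_iff.1 (hjk.trans_tendsto tendsto_fst_stageFilter)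
    have := ((hF.differentiable (by simp)) (y₀, y₀)).isBigO_sub.comp_tendsto hlim
    simpa using this.trans hjk
  refine (smul_sum_isBigO (M.a i) hb).congr' ?_ (by simp)
  filter_upwards [eventually_stageFilter] with q hq
  rw [hq.1 i]
  simp only [← Finset.sum_smul, add_sub_cancel_left]
  rfl

theorem stage_expansion_two (hF : ContDiff ℝ ∞ (Function.uncurry F)) (i : ι) :
    (fun q => q.2 i - y₀ - q.1 • M.c i • F y₀ y₀ - q.1 ^ 2 •
      ((∑ j, ∑ k, M.a i j k * M.c j) • partialFDeriv₁ F y₀ (F y₀ y₀)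
      + (∑ j, ∑ k, M.a i j k * M.c k) • partialFDeriv₂ F y₀ (F y₀ y₀)))
      =O[M.stageFilter F y₀] fun q => q.1 ^ 3 := by
  refine (smul_sum_isBigO (M.a i) fun j k => hF.expansion_one_pair tendsto_fst_stageFilter
    (stage_expansion_one hF j) (stage_expansion_one hF k)).congr' ?_ (by simp)
  filter_upwards [eventually_stageFilter] with q hq
  rw [hq.1 i]
  simp only [smul_add, Finset.sum_add_distrib, smul_smul, c, Finset.sum_smul,
    Finset.smul_sum]
  simp only [← Finset.sum_smul, mul_left_comm _ q.1, ← Finset.mul_sum]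
  module

theorem SecondOrderConditions.hasOrder (hM : M.SecondOrderConditions) : M.HasOrder 2 := by
  refine hasOrder_of_isBigO fun d F hF y hy => ?_
  have h1 := (solution_expansion_two hF hy).comp_tendsto
    (tendsto_fst_stageFilter (M := M) (F := F) (y₀ := y 0))
  have h2 := smul_sum_isBigO M.b fun j k => hF.expansion_one_pair tendsto_fst_stageFilter
    (stage_expansion_one (M := M) (y₀ := y 0) hF j) (stage_expansion_one hF k)
  refine (h2.sub h1).congr_left fun q => ?_
  simp only [output, Function.comp_apply]
  simp only [smul_add, Finset.sum_add_distrib, smul_smul, mul_left_comm _ q.1, ← Finset.sum_smul,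
    ← Finset.mul_sum, hM.sum_b, hM.sum_b_c₁, hM.sum_b_c₂]
  module

theorem sum_smul_expansion {W : Type*} [AddCommGroup W] [Module ℝ W] (β : ι → ι → ℝ) (x : W)
    (u v : ι → ι → W) (h h' : ℝ) :
    ∑ j, ∑ k, β j k • (x + h • u j k + h' • v j k) = (∑ j, ∑ k, β j k) • x
      + h • ∑ j, ∑ k, β j k • u j k + h' • ∑ j, ∑ k, β j k • v j k := by
  simp only [smul_add, Finset.sum_add_distrib, Finset.smul_sum, Finset.sum_smul, smul_comm h,
    smul_comm h']

theorem ThirdOrderConditions.hasOrder (hM : M.ThirdOrderConditions) : M.HasOrder 3 := by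
  refine hasOrder_of_isBigO fun d F hF y hy => ?_
  have h1 := (solution_expansion_three hF hy).comp_tendsto
    (tendsto_fst_stageFilter (M := M) (F := F) (y₀ := y 0))
  have h2 := smul_sum_isBigO M.b fun j k => hF.expansion_two_pair tendsto_fst_stageFilter
    (stage_expansion_two (M := M) (y₀ := y 0) hF j) (stage_expansion_two hF k)
  refine (h2.sub h1).congr_left fun q => ?_
  rw [sum_smul_expansion]
  simp only [output, Function.comp_apply]
  simp only [partialFDeriv₁_add, partialFDeriv₂_add, partialFDeriv₁_smul, partialFDeriv₂_smul,
    smul_add, Finset.sum_add_distrib, smul_smul, mul_left_comm _ (1 / 2 : ℝ), ← Finset.sum_smul,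
    ← Finset.mul_sum, hM.sum_b, hM.sum_b_c₁, hM.sum_b_c₂, hM.sum_b_c₁₁, hM.sum_b_c₁₂,
    hM.sum_b_c₂₂, hM.sum_b_a₁_c₁, hM.sum_b_a₁_c₂, hM.sum_b_a₂_c₁, hM.sum_b_a₂_c₂]
  module

end NPRKMethod

/-! ### Necessity of the classical order conditions -/

/-- A term of order at most `p` that is bounded by `C * h ^ (p + 1)` for all small `h` has
coefficient zero. -/
theorem eq_zero_of_abs_mul_pow_le {K C h₀ : ℝ} {k p : ℕ} (hk : k ≤ p) (h₀pos : 0 < h₀)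
    (H : ∀ h : ℝ, 0 < h → h ≤ h₀ → |K * h ^ k| ≤ C * h ^ (p + 1)) : K = 0 := by
  have hlim : Tendsto (fun h : ℝ => C * h ^ (p + 1 - k)) (𝓝[>] 0) (𝓝 0) := by
    have hc : Continuous fun h : ℝ => C * h ^ (p + 1 - k) := by fun_prop
    have := (hc.tendsto 0).mono_left (nhdsWithin_le_nhds (s := Set.Ioi 0))
    rwa [zero_pow (by omega), mul_zero] at this
  have : |K| ≤ 0 := by
    refine ge_of_tendsto hlim ?_
    filter_upwards [Ioc_mem_nhdsGT h₀pos] with h hh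
    have h1 := H h hh.1 hh.2
    have h2 : 0 < h ^ k := pow_pos hh.1 k
    rw [abs_mul, abs_of_pos h2, show p + 1 = (p + 1 - k) + k by omega, pow_add, ← mul_assoc] at h1
    exact le_of_mul_le_mul_right h1 h2
  exact abs_nonpos_iff.1 this

namespace RKMethod

variable {ι : Type} [Fintype ι] {M : RKMethod ι} {p : ℕ}

/-- A test system for reading off the order conditions: the first component is the time `t`, the
second is `t ^ 2 / 2`, and the third integrates `κ₀ + κ₁ t + κ₂ t ^ 2 + κ₃ t ^ 2 / 2`, with the last
term taken from the second component. -/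
def testField (κ : Fin 4 → ℝ) (x : Fin 3 → ℝ) : Fin 3 → ℝ :=
  ![1, x 0, κ 0 + κ 1 * x 0 + κ 2 * x 0 ^ 2 + κ 3 * x 1]

/-- The solution of the test system that starts at the origin. -/
noncomputable def testSolution (κ : Fin 4 → ℝ) (t : ℝ) : Fin 3 → ℝ :=
  ![t, t ^ 2 / 2, κ 0 * t + κ 1 * (t ^ 2 / 2) + κ 2 * (t ^ 3 / 3) + κ 3 * (t ^ 3 / 6)]

theorem contDiff_testField (κ : Fin 4 → ℝ) : ContDiff ℝ ∞ (testField κ) := by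
  refine contDiff_pi.2 fun i => ?_
  fin_cases i <;> simp [testField] <;> fun_prop

theorem hasDerivAt_testSolution (κ : Fin 4 → ℝ) (t : ℝ) :
    HasDerivAt (testSolution κ) (testField κ (testSolution κ t)) t := by
  have h2 : HasDerivAt (fun t : ℝ => t ^ 2 / 2) t t := by
    simpa using (hasDerivAt_pow 2 t).div_const 2
  have h3 := hasDerivAt_pow 3 t
  refine hasDerivAt_pi.2 fun i => ?_
  fin_cases i
  · exact hasDerivAt_id t
  · simpa [testField, testSolution] using h2
  · refine (((((hasDerivAt_id t).const_mul (κ 0)).add (h2.const_mul (κ 1))).add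
      ((h3.div_const 3).const_mul (κ 2))).add ((h3.div_const 6).const_mul (κ 3))).congr_deriv ?_
    simp [testField, testSolution]
    ring_nf
    simp

/-- One step on the test system has an error whose coefficients are the defects in the four order
conditions. -/
theorem HasOrder.testField_bound (hM : M.HasOrder p) (κ : Fin 4 → ℝ) :
    ∃ h₀ > 0, ∃ C : ℝ, ∀ h : ℝ, 0 < h → h ≤ h₀ →
      |κ 0 * (∑ i, M.b i - 1) * h + κ 1 * (∑ i, M.b i * M.c i - 1 / 2) * h ^ 2
        + κ 2 * (∑ i, M.b i * M.c i ^ 2 - 1 / 3) * h ^ 3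
        + κ 3 * (∑ i, M.b i * ∑ j, M.A i j * M.c j - 1 / 6) * h ^ 3| ≤ C * h ^ (p + 1) := by
  obtain ⟨r, -, h₀, h₀pos, C, H⟩ := hM 3 (testField κ) (contDiff_testField κ) (testSolution κ)
    (Eventually.of_forall (hasDerivAt_testSolution κ))
  refine ⟨h₀, h₀pos, C, fun h hpos hh => ?_⟩
  obtain ⟨⟨Y, hY, hYr⟩, hout⟩ := H h hpos hh
  have hy0 : testSolution κ 0 = 0 := by
    ext i; fin_cases i <;> simp [testSolution]
  have hY0 : ∀ i, Y i 0 = h * M.c i := by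
    intro i
    have := congrFun (hY i) 0
    simpa [hy0, testField, c, Finset.sum_apply] using this
  have hY1 : ∀ i, Y i 1 = h * (h * ∑ j, M.A i j * M.c j) := by
    intro i
    have := congrFun (hY i) 1
    simpa [hy0, testField, Finset.sum_apply, hY0, mul_left_comm _ h, ← Finset.mul_sum] using this
  refine le_trans (le_of_eq ?_) ((norm_le_pi_norm _ 2).trans (hout Y hY hYr))
  rw [Real.norm_eq_abs]
  congr 1
  simp only [output, Pi.sub_apply, Pi.add_apply, Pi.smul_apply, Finset.sum_apply, testField,
    testSolution, smul_eq_mul, hY0, hY1, Matrix.cons_val, mul_add,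
    Finset.sum_add_distrib, mul_pow]
  simp only [mul_left_comm _ (κ _), mul_left_comm (M.b _) h, mul_left_comm (M.b _) (h ^ 2),
    ← Finset.mul_sum, mul_comm (M.b _) (κ 0)]
  ring

theorem HasOrder.sum_b (hM : M.HasOrder p) (hp : 1 ≤ p) : ∑ i, M.b i = 1 := by
  obtain ⟨h₀, h₀pos, C, H⟩ := hM.testField_bound ![1, 0, 0, 0]
  exact sub_eq_zero.1 (eq_zero_of_abs_mul_pow_le (C := C) hp h₀pos (by simpa using H))

theorem HasOrder.sum_b_c (hM : M.HasOrder p) (hp : 2 ≤ p) : ∑ i, M.b i * M.c i = 1 / 2 := by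
  obtain ⟨h₀, h₀pos, C, H⟩ := hM.testField_bound ![0, 1, 0, 0]
  exact sub_eq_zero.1 (eq_zero_of_abs_mul_pow_le (C := C) hp h₀pos (by simpa using H))

theorem HasOrder.sum_b_c_sq (hM : M.HasOrder p) (hp : 3 ≤ p) :
    ∑ i, M.b i * M.c i ^ 2 = 1 / 3 := by
  obtain ⟨h₀, h₀pos, C, H⟩ := hM.testField_bound ![0, 0, 1, 0]
  exact sub_eq_zero.1 (eq_zero_of_abs_mul_pow_le (C := C) hp h₀pos (by simpa using H))

theorem HasOrder.sum_b_A_c (hM : M.HasOrder p) (hp : 3 ≤ p) :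
    ∑ i, M.b i * ∑ j, M.A i j * M.c j = 1 / 6 := by
  obtain ⟨h₀, h₀pos, C, H⟩ := hM.testField_bound ![0, 0, 0, 1]
  exact sub_eq_zero.1 (eq_zero_of_abs_mul_pow_le (C := C) hp h₀pos (by simpa using H))

end RKMethod

/-! ### L-stability from triangular structure -/

namespace NPRKMethod

variable {ι : Type} [Fintype ι] {M : NPRKMethod ι}

theorem stabMatrix_apply (z₁ z₂ : ℂ) (i j : ι) : M.stabMatrix z₁ z₂ i j =
    z₁ * (M.underlying₁.A i j : ℂ) + z₂ * (M.underlying₂.A i j : ℂ) := by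
  simp [stabMatrix]

theorem eventually_diag_ne_zero (M : NPRKMethod ι) :
    ∀ᶠ z₁ in Bornology.cobounded ℂ, ∀ i, 1 - z₁ * (M.underlying₁.A i i : ℂ) ≠ 0 := by
  refine eventually_all.2 fun i => ?_
  by_cases hi : M.underlying₁.A i i = 0
  · simp [hi]
  · have hi' : (M.underlying₁.A i i : ℂ) ≠ 0 := by exact_mod_cast hi
    filter_upwards [Bornology.eventually_ne_cobounded ((M.underlying₁.A i i : ℂ)⁻¹)] with z hz h
    exact hz (eq_inv_of_mul_eq_one_left (sub_eq_zero.1 h).symm)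

variable [DecidableEq ι]

theorem underlying₁_A_apply (M : NPRKMethod ι) (i j : ι) :
    M.underlying₁.A i j = ∑ p, ∑ q, M.a i p q * if p = j then 1 else 0 := by
  simp [underlying₁, Finset.sum_ite_irrel]

theorem underlying₂_A_apply (M : NPRKMethod ι) (i j : ι) :
    M.underlying₂.A i j = ∑ p, ∑ q, M.a i p q * if q = j then 1 else 0 := by
  simp [underlying₂]

/-- For a stiffly accurate method the stability function is the final component of the solution
`x = (I - z₁ A₁ - z₂ A₂)⁻¹ e` of the stage equations for the linear test problem. -/
theorem IsStifflyAccurate.stabFun_eq {f : ι} (hf : M.IsStifflyAccurate f) {z₁ z₂ : ℂ}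
    (hden : M.stabDen z₁ z₂ ≠ 0) :
    M.stabFun z₁ z₂ = ((1 - M.stabMatrix z₁ z₂)⁻¹).mulVec (fun _ => 1) f := by
  have hu : IsUnit (1 - M.stabMatrix z₁ z₂).det := isUnit_iff_ne_zero.2 hden
  set x := ((1 - M.stabMatrix z₁ z₂)⁻¹).mulVec (fun _ => 1) with hx
  have hAx : (1 - M.stabMatrix z₁ z₂).mulVec x = fun _ => 1 := by
    rw [hx, Matrix.mulVec_mulVec, Matrix.mul_nonsing_inv _ hu, Matrix.one_mulVec]
  have hxf := congrFun hAx f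
  rw [Matrix.sub_mulVec, Matrix.one_mulVec, Pi.sub_apply] at hxf
  have hrow : M.stabMatrix z₁ z₂ f = M.stabVector z₁ z₂ := by
    ext j
    simp only [stabMatrix_apply, stabVector, underlying₁, underlying₂, Matrix.of_apply,
      show M.b = M.a f from funext fun j => funext fun k => hf j k]
  have hnum : M.stabNum z₁ z₂ = M.stabDen z₁ z₂ * x f := by
    rw [stabNum, Matrix.vecMulVec_eq Unit, Matrix.det_add_replicateCol_mul_replicateRow hu, stabDen,
      Matrix.mul_assoc, ← Matrix.replicateCol_mulVec, ← hx, Matrix.det_unique (n := Unit)]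
    congr 1
    rw [sub_eq_iff_eq_add] at hxf
    rw [hxf, Matrix.mulVec, hrow]
    simp [Matrix.mul_apply, dotProduct]
  rw [stabFun, hnum, mul_div_cancel_left₀ _ hden]

/-- The triangular structure behind L-stability: with respect to the rank `ρ` both underlying
methods are lower triangular, the second one strictly, and only implicit stages, those with a
nonzero diagonal entry in the first underlying method, occur in the stiff argument. -/
structure IsStiffTriangular (M : NPRKMethod ι) (ρ : ι → ℕ) : Prop where
  lower₁ : ∀ i j, j ≠ i → ρ i ≤ ρ j → M.underlying₁.A i j = 0
  lower₂ : ∀ i j, ρ i ≤ ρ j → M.underlying₂.A i j = 0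
  column : ∀ j, M.underlying₁.A j j = 0 → ∀ i, M.underlying₁.A i j = 0


namespace IsStiffTriangular

variable {ρ : ι → ℕ}

theorem mulVec_apply (hM : M.IsStiffTriangular ρ) (z₁ z₂ : ℂ) (x : ι → ℂ) (i : ι) :
    (1 - M.stabMatrix z₁ z₂).mulVec x i = (1 - z₁ * (M.underlying₁.A i i : ℂ)) * x i
      - ∑ j with ρ j < ρ i, M.stabMatrix z₁ z₂ i j * x j := by
  have h : ∀ j, ¬ (ρ j < ρ i) → j ≠ i → M.stabMatrix z₁ z₂ i j * x j = 0 := by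
    intro j hj hji
    rw [stabMatrix_apply, hM.lower₁ i j hji (not_lt.1 hj), hM.lower₂ i j (not_lt.1 hj)]
    simp
  rw [Matrix.sub_mulVec, Matrix.one_mulVec, Pi.sub_apply, Matrix.mulVec, dotProduct,
    ← Finset.sum_filter_add_sum_filter_not Finset.univ (fun j => ρ j < ρ i),
    Finset.sum_eq_single_of_mem (s := Finset.univ.filter fun j => ¬ ρ j < ρ i) i (by simp)
      (fun j hj hji => h j (by simpa using hj) hji),
    stabMatrix_apply _ _ i i, hM.lower₂ i i le_rfl]
  simp
  ring

theorem eventually_stabDen_ne_zero (hM : M.IsStiffTriangular ρ) (z₂ : ℂ) :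
    ∀ᶠ z₁ in Bornology.cobounded ℂ, M.stabDen z₁ z₂ ≠ 0 := by
  filter_upwards [eventually_diag_ne_zero M] with z₁ hz hdet
  obtain ⟨v, hv0, hv⟩ := Matrix.exists_mulVec_eq_zero_iff.2 hdet
  refine hv0 (funext fun i => ?_)
  induction hn : ρ i using Nat.strong_induction_on generalizing i with
  | _ n ih =>
    have h := congrFun hv i
    rw [hM.mulVec_apply, Finset.sum_eq_zero, sub_zero] at h
    · exact (mul_eq_zero.1 h).resolve_left (hz i)
    · intro j hj
      rw [ih (ρ j) (by simpa [hn] using hj) j rfl, Pi.zero_apply, mul_zero]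

/-- As the stiff variable grows, the stage values of the linear test problem stay bounded, and those
of the implicit stages decay like `1 / z₁`. -/
theorem isBigO_stages (hM : M.IsStiffTriangular ρ) (z₂ : ℂ) {x : ℂ → ι → ℂ}
    (hx : ∀ᶠ z₁ in Bornology.cobounded ℂ, (1 - M.stabMatrix z₁ z₂).mulVec (x z₁) = fun _ => 1)
    (i : ι) :
    (fun z₁ => x z₁ i) =O[Bornology.cobounded ℂ] (fun _ => (1 : ℂ)) ∧
    (M.underlying₁.A i i ≠ 0 → (fun z₁ => x z₁ i) =O[Bornology.cobounded ℂ] fun z₁ => z₁⁻¹) := by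
  induction hn : ρ i using Nat.strong_induction_on generalizing i with
  | _ n ih =>
    have hinv : (fun z : ℂ => z⁻¹) =O[Bornology.cobounded ℂ] (fun _ => (1 : ℂ)) :=
      tendsto_inv₀_cobounded.isBigO_one ℂ
    have hterm : ∀ j, ρ j < ρ i → (fun z₁ => M.stabMatrix z₁ z₂ i j * x z₁ j)
        =O[Bornology.cobounded ℂ] (fun _ => (1 : ℂ)) := by
      intro j hj
      obtain ⟨h1, h2⟩ := ih (ρ j) (hn ▸ hj) j rfl
      simp only [stabMatrix_apply, add_mul, mul_assoc]
      refine IsBigO.add ?_ ((h1.const_mul_left _).const_mul_left _)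
      by_cases hjj : M.underlying₁.A j j = 0
      · simp only [hM.column j hjj i, Complex.ofReal_zero, zero_mul, mul_zero]
        exact isBigO_zero _ _
      · refine ((isBigO_refl (fun z : ℂ => z) _).mul ((h2 hjj).const_mul_left _)).trans ?_
        refine IsBigO.of_bound 1 ?_
        filter_upwards [Bornology.eventually_ne_cobounded (0 : ℂ)] with z hz
        rw [mul_inv_cancel₀ hz]
        simp
    have hsum : (fun z₁ => 1 + ∑ j with ρ j < ρ i, M.stabMatrix z₁ z₂ i j * x z₁ j)
        =O[Bornology.cobounded ℂ] (fun _ => (1 : ℂ)) :=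
      (isBigO_refl _ _).add (IsBigO.fun_sum fun j hj => hterm j (by simpa using hj))
    have hrow : (fun z₁ => (1 - z₁ * (M.underlying₁.A i i : ℂ)) * x z₁ i)
        =O[Bornology.cobounded ℂ] (fun _ => (1 : ℂ)) := by
      refine hsum.congr' ?_ EventuallyEq.rfl
      filter_upwards [hx] with z₁ hz
      have h := congrFun hz i
      rw [hM.mulVec_apply] at h
      linear_combination -h
    have himp : M.underlying₁.A i i ≠ 0 →
        (fun z₁ => x z₁ i) =O[Bornology.cobounded ℂ] fun z₁ => z₁⁻¹ := by
      intro hi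
      have hi' : (M.underlying₁.A i i : ℂ) ≠ 0 := by exact_mod_cast hi
      -- `(1 - z₁ a)⁻¹ = z₁⁻¹ (z₁⁻¹ - a)⁻¹`, and the second factor tends to `-a⁻¹`
      have hdiag : (fun z₁ : ℂ => (1 - z₁ * (M.underlying₁.A i i : ℂ))⁻¹)
          =O[Bornology.cobounded ℂ] fun z₁ => z₁⁻¹ := by
        have hlim : Tendsto (fun z : ℂ => (z⁻¹ - (M.underlying₁.A i i : ℂ))⁻¹)
            (Bornology.cobounded ℂ) (𝓝 (0 - (M.underlying₁.A i i : ℂ))⁻¹) :=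
          (tendsto_inv₀_cobounded.sub_const _).inv₀ (by simpa using hi')
        refine ((isBigO_refl (fun z : ℂ => z⁻¹) _).mul (hlim.isBigO_one ℂ)).congr' ?_ (by simp)
        filter_upwards [Bornology.eventually_ne_cobounded (0 : ℂ)] with z hz
        rw [← mul_inv, mul_sub, mul_inv_cancel₀ hz]
      refine (hdiag.mul hrow).congr' ?_ (by simp)
      filter_upwards [eventually_diag_ne_zero M] with z hz
      rw [inv_mul_cancel_left₀ (hz i)]
    refine ⟨?_, himp⟩
    by_cases hi : M.underlying₁.A i i = 0
    · simpa [hi] using hrow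
    · exact (himp hi).trans hinv

theorem isLStableZ₁ (hM : M.IsStiffTriangular ρ) {f : ι} (hf : M.IsStifflyAccurate f)
    (hff : M.underlying₁.A f f ≠ 0) : M.IsLStableZ₁ := by
  intro z₂
  have hden := hM.eventually_stabDen_ne_zero z₂
  refine ⟨hden, ?_⟩
  have hx : ∀ᶠ z₁ in Bornology.cobounded ℂ, (1 - M.stabMatrix z₁ z₂).mulVec
      (((1 - M.stabMatrix z₁ z₂)⁻¹).mulVec fun _ => 1) = fun _ => 1 := by
    filter_upwards [hden] with z₁ hz
    rw [Matrix.mulVec_mulVec, Matrix.mul_nonsing_inv _ (isUnit_iff_ne_zero.2 hz),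
      Matrix.one_mulVec]
  refine (((hM.isBigO_stages z₂ hx f).2 hff).trans_tendsto tendsto_inv₀_cobounded).congr' ?_
  filter_upwards [hden] with z₁ hz
  rw [hf.stabFun_eq hz]

end IsStiffTriangular

end NPRKMethod

/-! ### The second-order wrapped method -/

theorem RKMethod.IsExplicit.c_zero {s : ℕ} {E : RKMethod (Fin (s + 1))} (hE : E.IsExplicit) :
    E.c 0 = 0 :=
  Finset.sum_eq_zero fun j _ => hE 0 j (Fin.zero_le j)

/-- A ranking of the stages of a wrapped method that makes it lower triangular: the first explicit
stage, then all implicit stages but the last one, then the other explicit stages, then the last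
implicit stage. -/
def wrappedRank (n k : ℕ) : Fin (n + 1) ⊕ Fin (k + 1) → ℕ
  | .inl i => if i = 0 then 0 else i + k + 1
  | .inr j => if j = Fin.last k then n + k + 2 else j + 1

theorem le_of_wrappedRank_inl_le {n k : ℕ} {i j : Fin (n + 1)}
    (h : wrappedRank n k (.inl i) ≤ wrappedRank n k (.inl j)) : i ≤ j := by
  by_contra hlt
  have hi : i ≠ 0 := fun hi => hlt (hi ▸ Fin.zero_le j)
  rcases eq_or_ne j 0 with rfl | hj
  · simp [wrappedRank, hi] at h
  · simp [wrappedRank, hi, hj] at h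
    exact hlt h

section SecondOrder

variable {m : ℕ} (E : RKMethod (Fin (m + 1))) (γ : ℝ)

theorem implicitlyWrapped₂_sum_inl (i : Fin (m + 1))
    (g : Fin (m + 1) ⊕ Fin 2 → Fin (m + 1) ⊕ Fin 2 → ℝ) :
    ∑ j, ∑ k, (implicitlyWrapped₂ E γ).a (.inl i) j k * g j k =
      ∑ k, E.A i k * g (.inr 0) (.inl k) := by
  simp [implicitlyWrapped₂, Fintype.sum_sum_type]

theorem implicitlyWrapped₂_sum_inr_zero (g : Fin (m + 1) ⊕ Fin 2 → Fin (m + 1) ⊕ Fin 2 → ℝ) :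
    ∑ j, ∑ k, (implicitlyWrapped₂ E γ).a (.inr 0) j k * g j k = γ * g (.inr 0) (.inl 0) := by
  simp [implicitlyWrapped₂, Fintype.sum_sum_type]

theorem implicitlyWrapped₂_sum_b (g : Fin (m + 1) ⊕ Fin 2 → Fin (m + 1) ⊕ Fin 2 → ℝ) :
    ∑ j, ∑ k, (implicitlyWrapped₂ E γ).b j k * g j k = ∑ k, E.b k * g (.inr 0) (.inl k)
      + γ * (g (.inr 1) (.inl (Fin.last m)) - g (.inr 0) (.inl (Fin.last m))) := by
  simp [implicitlyWrapped₂, Fintype.sum_sum_type, sub_mul, Finset.sum_sub_distrib]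
  ring

variable {E γ}

theorem implicitlyWrapped₂_secondOrderConditions (hb : ∑ i, E.b i = 1)
    (hbc : ∑ i, E.b i * E.c i = 1 / 2) (hγ : 2 * γ - γ ^ 2 = 1 / 2) :
    (implicitlyWrapped₂ E γ).SecondOrderConditions := by
  have hc : ∀ i, (implicitlyWrapped₂ E γ).c i =
      ∑ j, ∑ k, (implicitlyWrapped₂ E γ).a i j k * (fun _ _ => 1) j k := by
    simp [NPRKMethod.c]
  have hc_inl : ∀ i, (implicitlyWrapped₂ E γ).c (.inl i) = E.c i := fun i => by
    rw [hc, implicitlyWrapped₂_sum_inl]; simp [RKMethod.c]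
  have hc_zero : (implicitlyWrapped₂ E γ).c (.inr 0) = γ := by
    rw [hc, implicitlyWrapped₂_sum_inr_zero]; simp
  have hsum : ∑ i, ∑ j, (implicitlyWrapped₂ E γ).b i j * (fun _ _ => 1) i j = 1 := by
    rw [implicitlyWrapped₂_sum_b]; simp [hb]
  have hc_one : (implicitlyWrapped₂ E γ).c (.inr 1) = 1 := (hc _).trans hsum
  refine ⟨by simpa using hsum, ?_, ?_⟩
  · rw [implicitlyWrapped₂_sum_b E γ fun i _ => (implicitlyWrapped₂ E γ).c i]
    rw [hc_zero, hc_one, ← Finset.sum_mul, hb]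
    linear_combination hγ
  · rw [implicitlyWrapped₂_sum_b E γ fun _ j => (implicitlyWrapped₂ E γ).c j]
    simp only [hc_inl, hbc, sub_self, mul_zero, add_zero]

theorem implicitlyWrapped₂_isStiffTriangular (hE : E.IsExplicit) (hγ : γ ≠ 0) :
    (implicitlyWrapped₂ E γ).IsStiffTriangular (wrappedRank m 1) := by
  have hA0 : ∀ k, E.A 0 k = 0 := fun k => hE 0 k (Fin.zero_le k)
  refine ⟨?_, ?_, ?_⟩
  · rintro (i | i) (j | j) hij h
    · simp [NPRKMethod.underlying₁, implicitlyWrapped₂, Fintype.sum_sum_type]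
    · rcases eq_or_ne i 0 with rfl | hi
      · fin_cases j <;>
          simp [NPRKMethod.underlying₁, implicitlyWrapped₂, Fintype.sum_sum_type, hA0]
      · fin_cases j
        · simp [wrappedRank, hi] at h
        · simp [NPRKMethod.underlying₁, implicitlyWrapped₂, Fintype.sum_sum_type]
    · fin_cases i <;> simp [NPRKMethod.underlying₁, implicitlyWrapped₂, Fintype.sum_sum_type]
    · fin_cases i <;> fin_cases j <;> simp [wrappedRank] at h hij;
        simp [NPRKMethod.underlying₁, implicitlyWrapped₂, Fintype.sum_sum_type]
  · rintro (i | i) (j | j) h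
    · have hij := le_of_wrappedRank_inl_le h
      simpa [NPRKMethod.underlying₂, implicitlyWrapped₂, Fintype.sum_sum_type] using hE i j hij
    · simp [NPRKMethod.underlying₂, implicitlyWrapped₂, Fintype.sum_sum_type]
    · have hj : i = 0 → j ≠ 0 := by
        rintro rfl rfl
        simp [wrappedRank] at h
      fin_cases i
      · simp [NPRKMethod.underlying₂, implicitlyWrapped₂, Fintype.sum_sum_type, hj]
      · have := j.isLt
        by_cases hj0 : j = 0 <;> simp [wrappedRank, hj0] at h
        omega
    · fin_cases i <;> simp [NPRKMethod.underlying₂, implicitlyWrapped₂, Fintype.sum_sum_type]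
  · rintro (j | j) hj i
    · rcases i with i | i
      · simp [NPRKMethod.underlying₁, implicitlyWrapped₂, Fintype.sum_sum_type]
      · fin_cases i <;> simp [NPRKMethod.underlying₁, implicitlyWrapped₂, Fintype.sum_sum_type]
    · fin_cases j <;>
        simp [NPRKMethod.underlying₁, implicitlyWrapped₂, Fintype.sum_sum_type, hγ] at hj

end SecondOrder

/-! ### The third-order wrapped methods -/

section ThirdOrder

variable {m : ℕ}

/-- The common form of the two third-order wrapped methods. An explicit stage `i` evaluates with
stage `3` in the first argument with coefficients `e i`, the final stage with coefficients `β`, and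
stage `2` takes the remaining part of the coefficients of the explicit method. -/
noncomputable def wrapped₃ (lam : ℝ) (w : ℕ) (E : RKMethod (Fin (m + 2)))
    (e : Matrix (Fin (m + 2)) (Fin (m + 2)) ℝ) (β : Fin (m + 2) → ℝ) :
    NPRKMethod (Fin (m + 2) ⊕ Fin 3) :=
  let a : Fin (m + 2) ⊕ Fin 3 → Fin (m + 2) ⊕ Fin 3 → Fin (m + 2) ⊕ Fin 3 → ℝ
    | .inr 0, .inr 0, .inl k => if k = 0 then lam else 0
    | .inr 1, .inr 0, .inl k => if k = 0 then (1 - lam) / 2 - coupling₃₂₂ lam w else 0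
    | .inr 1, .inr 0, .inr 0 => coupling₃₂₂ lam w
    | .inr 1, .inr 1, .inl k => if k = 0 ∧ w = 1 then lam else 0
    | .inr 1, .inr 1, .inr 0 => if w = 2 then lam else 0
    | .inl i, .inr 0, .inl k => E.A i k - e i k
    | .inl i, .inr 1, .inl k => e i k
    | .inr 2, .inr 0, .inl k => E.b k - β k - if k = Fin.last (m + 1) then lam else 0
    | .inr 2, .inr 1, .inl k => β k
    | .inr 2, .inr 2, .inl k => if k = Fin.last (m + 1) then lam else 0
    | _, _, _ => 0
  { a := a, b := a (.inr 2) }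

variable (lam : ℝ) (w : ℕ) (E : RKMethod (Fin (m + 2)))
  (e : Matrix (Fin (m + 2)) (Fin (m + 2)) ℝ) (β : Fin (m + 2) → ℝ)

theorem implicitlyWrapped₃_eq : implicitlyWrapped₃ lam w E = wrapped₃ lam w E
    (fun i k => if i = Fin.last (m + 1) ∧ k = (Fin.last m).castSucc then couplingExpl lam E else 0)
    (fun k => (if k = 0 then couplingOut lam E else 0) + if k = Fin.last (m + 1) then
      (6 * lam ^ 2 - 20 * lam + 5) / 4 - couplingOut lam E else 0) := by
  have ha : (implicitlyWrapped₃ lam w E).a = (wrapped₃ lam w E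
    (fun i k => if i = Fin.last (m + 1) ∧ k = (Fin.last m).castSucc then couplingExpl lam E else 0)
    (fun k => (if k = 0 then couplingOut lam E else 0) + if k = Fin.last (m + 1) then
      (6 * lam ^ 2 - 20 * lam + 5) / 4 - couplingOut lam E else 0)).a := by
    funext i j k
    rcases i with i | i <;> rcases j with j | j <;> rcases k with k | k
    all_goals try fin_cases i
    all_goals try fin_cases j
    all_goals try fin_cases k
    all_goals try rfl
    change E.b k - (if k = 0 then couplingOut lam E else 0) - (if k = Fin.last (m + 1) then
        (6 * lam ^ 2 - 20 * lam + 5) / 4 - couplingOut lam E + lam else 0) =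
      E.b k - ((if k = 0 then couplingOut lam E else 0) + if k = Fin.last (m + 1) then
        (6 * lam ^ 2 - 20 * lam + 5) / 4 - couplingOut lam E else 0)
        - if k = Fin.last (m + 1) then lam else 0
    split_ifs <;> ring
  exact congrArg (fun a => NPRKMethod.mk a (a (.inr 2))) ha

theorem implicitlyWrapped₃'_eq : implicitlyWrapped₃' lam w E = wrapped₃ lam w E
    (fun i k => E.A i k * couplingDelta lam)
    (fun k => if k = 0 then couplingOut' lam E else if k = Fin.last (m + 1) then
      couplingX₁ lam E - couplingOut' lam E else E.b k * couplingDelta lam) := by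
  have ha : (implicitlyWrapped₃' lam w E).a = (wrapped₃ lam w E
    (fun i k => E.A i k * couplingDelta lam)
    (fun k => if k = 0 then couplingOut' lam E else if k = Fin.last (m + 1) then
      couplingX₁ lam E - couplingOut' lam E else E.b k * couplingDelta lam)).a := by
    funext i j k
    rcases i with i | i <;> rcases j with j | j <;> rcases k with k | k
    all_goals try fin_cases i
    all_goals try fin_cases j
    all_goals try fin_cases k
    all_goals try rfl
    · change E.A i k * (1 - couplingDelta lam) = E.A i k - E.A i k * couplingDelta lam
      ring
    · change (if k = 0 then E.b 0 - couplingOut' lam E else if k = Fin.last (m + 1) then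
          E.b (Fin.last (m + 1)) - ((sdirk₃ lam).A 2 1 - couplingOut' lam E
            - couplingDelta lam * (1 - E.b 0 - E.b (Fin.last (m + 1)))) - lam
          else E.b k * (1 - couplingDelta lam)) =
        E.b k - (if k = 0 then couplingOut' lam E else if k = Fin.last (m + 1) then
          couplingX₁ lam E - couplingOut' lam E else E.b k * couplingDelta lam)
          - if k = Fin.last (m + 1) then lam else 0
      rcases eq_or_ne k 0 with rfl | h0
      · simp [Fin.ext_iff]
      · rcases eq_or_ne k (Fin.last (m + 1)) with rfl | h1
        · simp only [h0, if_false, if_true, couplingX₁]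
          ring
        · simp only [h0, h1, if_false]
          ring
    · change (if k = 0 then couplingOut' lam E else if k = Fin.last (m + 1) then
          (sdirk₃ lam).A 2 1 - couplingOut' lam E
            - couplingDelta lam * (1 - E.b 0 - E.b (Fin.last (m + 1)))
          else E.b k * couplingDelta lam) =
        if k = 0 then couplingOut' lam E else if k = Fin.last (m + 1) then
          couplingX₁ lam E - couplingOut' lam E else E.b k * couplingDelta lam
      rw [couplingX₁, sub_right_comm]
  exact congrArg (fun a => NPRKMethod.mk a (a (.inr 2))) ha

theorem wrapped₃_sum_inl (i : Fin (m + 2))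
    (g : Fin (m + 2) ⊕ Fin 3 → Fin (m + 2) ⊕ Fin 3 → ℝ) :
    ∑ j, ∑ k, (wrapped₃ lam w E e β).a (.inl i) j k * g j k =
      ∑ k, E.A i k * g (.inr 0) (.inl k)
        + ∑ k, e i k * (g (.inr 1) (.inl k) - g (.inr 0) (.inl k)) := by
  simp [wrapped₃, Fintype.sum_sum_type, Fin.sum_univ_three, sub_mul, mul_sub,
    Finset.sum_sub_distrib]
  ring

theorem wrapped₃_sum_inr_zero (g : Fin (m + 2) ⊕ Fin 3 → Fin (m + 2) ⊕ Fin 3 → ℝ) :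
    ∑ j, ∑ k, (wrapped₃ lam w E e β).a (.inr 0) j k * g j k = lam * g (.inr 0) (.inl 0) := by
  simp [wrapped₃, Fintype.sum_sum_type, Fin.sum_univ_three]

theorem wrapped₃_sum_inr_one (hw : w = 1 ∨ w = 2)
    (g : Fin (m + 2) ⊕ Fin 3 → Fin (m + 2) ⊕ Fin 3 → ℝ) :
    ∑ j, ∑ k, (wrapped₃ lam w E e β).a (.inr 1) j k * g j k =
      ((1 - lam) / 2 - coupling₃₂₂ lam w) * g (.inr 0) (.inl 0)
        + coupling₃₂₂ lam w * g (.inr 0) (.inr 0)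
        + lam * g (.inr 1) (if w = 1 then .inl 0 else .inr 0) := by
  rcases hw with rfl | rfl <;> simp [wrapped₃, Fintype.sum_sum_type, Fin.sum_univ_three]

/-- The weights of the wrapped method, paired with an arbitrary `g`. Taking for `g` a function of
one argument, a product or a constant gives the left-hand sides of the order conditions. -/
theorem wrapped₃_sum_b (g : Fin (m + 2) ⊕ Fin 3 → Fin (m + 2) ⊕ Fin 3 → ℝ) :
    ∑ j, ∑ k, (wrapped₃ lam w E e β).b j k * g j k = ∑ k, E.b k * g (.inr 0) (.inl k)
      + ∑ k, β k * (g (.inr 1) (.inl k) - g (.inr 0) (.inl k))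
      + lam * (g (.inr 2) (.inl (Fin.last (m + 1))) - g (.inr 0) (.inl (Fin.last (m + 1)))) := by
  simp [wrapped₃, Fintype.sum_sum_type, Fin.sum_univ_three, sub_mul, mul_sub,
    Finset.sum_sub_distrib]
  ring

variable {lam w E e β}

/-- The order conditions for the common form, given those of `E`. The last three hypotheses fix what
the couplings have to satisfy: `hβ` makes the weights summed over the second argument those of the
SDIRK method, `hβc` is the condition on `b i j * c i * c j`, and `hbe` the one on
`b i j * a j k l * c k`. The remaining mixed condition, on `b i j * a i k l * c l`, determines
`coupling₃₂₂`. -/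
theorem wrapped₃_thirdOrderConditions
    (hlam : 1 / 6 - 3 / 2 * lam + 3 * lam ^ 2 - lam ^ 3 = 0)
    (hlam0 : lam ≠ 0) (hlam' : 6 * lam ^ 2 - 20 * lam + 5 ≠ 0) (hw : w = 1 ∨ w = 2)
    (hE : E.IsExplicit)
    (hb : ∑ i, E.b i = 1) (hbc : ∑ i, E.b i * E.c i = 1 / 2)
    (hbc2 : ∑ i, E.b i * E.c i ^ 2 = 1 / 3)
    (hbAc : ∑ i, E.b i * ∑ j, E.A i j * E.c j = 1 / 6)
    (hβ : ∑ k, β k = (6 * lam ^ 2 - 20 * lam + 5) / 4)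
    (hβc : (1 - lam) / 2 * ∑ k, β k * E.c k =
      1 / 3 - lam / 2 - lam * (1 - lam) * E.c (Fin.last (m + 1)))
    (hbe : (1 - lam) / 2 * ∑ i, E.b i * ∑ k, e i k = (1 - 3 * lam) / 6) :
    (wrapped₃ lam w E e β).ThirdOrderConditions := by
  set M := wrapped₃ lam w E e β
  have hc : ∀ i, M.c i = ∑ j, ∑ k, M.a i j k * (fun _ _ => 1) j k := by
    simp [NPRKMethod.c]
  have hc_inl : ∀ i, M.c (.inl i) = E.c i := fun i => by
    rw [hc, wrapped₃_sum_inl]; simp [RKMethod.c]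
  have hc_zero : M.c (.inr 0) = lam := by
    rw [hc, wrapped₃_sum_inr_zero]; simp
  have hc_one : M.c (.inr 1) = (1 + lam) / 2 := by
    rw [hc, wrapped₃_sum_inr_one lam w E e β hw]; ring
  have hsum : ∑ i, ∑ j, M.b i j * (fun _ _ => 1) i j = 1 := by
    rw [wrapped₃_sum_b]; simp [hb]
  have hc_two : M.c (.inr 2) = 1 := (hc _).trans hsum
  have hc0 := hE.c_zero
  -- weights summed over the second argument are those of the SDIRK method
  have hb₁ : ∀ u : Fin (m + 2) ⊕ Fin 3 → ℝ, ∑ i, ∑ j, M.b i j * u i =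
      u (.inr 0) + (6 * lam ^ 2 - 20 * lam + 5) / 4 * (u (.inr 1) - u (.inr 0))
        + lam * (u (.inr 2) - u (.inr 0)) := fun u => by
    rw [wrapped₃_sum_b lam w E e β fun i _ => u i, ← Finset.sum_mul, ← Finset.sum_mul, hb, hβ,
      one_mul]
  -- weights summed over the first argument are those of the explicit method
  have hb₂ : ∀ u : Fin (m + 2) ⊕ Fin 3 → ℝ, ∑ i, ∑ j, M.b i j * u j =
      ∑ k, E.b k * u (.inl k) := fun u => by
    rw [wrapped₃_sum_b lam w E e β fun _ j => u j]
    simp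
  have hbc₁ : ∑ i, ∑ j, M.b i j * M.c i = 1 / 2 := by
    rw [hb₁, hc_zero, hc_one, hc_two]
    linear_combination (3 / 4) * hlam
  have hbc₂ : ∑ i, ∑ j, M.b i j * M.c j = 1 / 2 := by
    rw [hb₂]; simpa only [hc_inl] using hbc
  refine ⟨⟨by simpa using hsum, hbc₁, hbc₂⟩, ?_, ?_, ?_, ?_, ?_, ?_, ?_⟩
  · rw [hb₁ fun i => M.c i ^ 2, hc_zero, hc_one, hc_two]
    linear_combination (9 / 8 * lam - 1 / 8) * hlam
  · rw [wrapped₃_sum_b lam w E e β fun i j => M.c i * M.c j]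
    simp only [hc_zero, hc_one, hc_two, hc_inl, mul_left_comm _ lam, ← Finset.mul_sum, hbc,
      ← sub_mul, mul_left_comm _ ((1 + lam) / 2 - lam)]
    linear_combination hβc
  · rw [hb₂ fun j => M.c j ^ 2]; simpa only [hc_inl] using hbc2
  · rw [hb₁ fun i => ∑ k, ∑ l, M.a i k l * M.c k,
      wrapped₃_sum_inr_zero lam w E e β fun k _ => M.c k,
      wrapped₃_sum_inr_one lam w E e β hw fun k _ => M.c k]
    rw [show ∑ k, ∑ l, M.a (.inr 2) k l * M.c k = 1 / 2 from hbc₁, hc_zero, hc_one]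
    linear_combination (3 / 2 * lam - 1) * hlam
  · rw [hb₁ fun i => ∑ k, ∑ l, M.a i k l * M.c l,
      wrapped₃_sum_inr_zero lam w E e β fun _ l => M.c l,
      wrapped₃_sum_inr_one lam w E e β hw fun _ l => M.c l]
    rw [show ∑ k, ∑ l, M.a (.inr 2) k l * M.c l = 1 / 2 from hbc₂, hc_zero, hc_inl, hc0]
    have hden : 18 * lam ^ 3 - 60 * lam ^ 2 + 15 * lam ≠ 0 := by
      have : 18 * lam ^ 3 - 60 * lam ^ 2 + 15 * lam
        = 3 * lam * (6 * lam ^ 2 - 20 * lam + 5) := by ring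
      rw [this]; positivity
    have hcoup : (coupling₃₂₂ lam w + if w = 1 then 0 else lam) *
        (18 * lam ^ 3 - 60 * lam ^ 2 + 15 * lam) = 2 - 6 * lam := by
      rcases hw with rfl | rfl <;> simp [coupling₃₂₂, hden]
    rcases hw with rfl | rfl
    · simp only [if_true, hc_inl, hc0] at hcoup ⊢
      linear_combination (1 / 12) * hcoup
    · simp only [if_neg (show ¬ (2 = 1) by norm_num), hc_zero] at hcoup ⊢
      linear_combination (1 / 12) * hcoup
  · rw [hb₂ fun j => ∑ k, ∑ l, M.a j k l * M.c k]
    have hX : ∀ i, E.b i * ∑ k, ∑ l, M.a (.inl i) k l * M.c k =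
        lam * (E.b i * E.c i) + (1 - lam) / 2 * (E.b i * ∑ k, e i k) := fun i => by
      rw [wrapped₃_sum_inl lam w E e β i fun k _ => M.c k, hc_zero, hc_one, ← Finset.sum_mul,
        ← Finset.sum_mul, RKMethod.c]
      ring
    simp only [hX, Finset.sum_add_distrib, ← Finset.mul_sum, hbc]
    linear_combination hbe
  · rw [hb₂ fun j => ∑ k, ∑ l, M.a j k l * M.c l, ← hbAc]
    refine Finset.sum_congr rfl fun i _ => ?_
    rw [wrapped₃_sum_inl lam w E e β i fun _ l => M.c l]
    simp only [hc_inl, sub_self, mul_zero, Finset.sum_const_zero, add_zero]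

theorem wrapped₃_isStiffTriangular (hlam0 : lam ≠ 0) (hw : w = 1 ∨ w = 2) (hE : E.IsExplicit)
    (he : ∀ k, e 0 k = 0) :
    (wrapped₃ lam w E e β).IsStiffTriangular (wrappedRank (m + 1) 2) := by
  set M := wrapped₃ lam w E e β
  have hr0 : wrappedRank (m + 1) 2 (.inr 0) = 1 := by simp [wrappedRank]
  have hr1 : wrappedRank (m + 1) 2 (.inr 1) = 2 := by simp [wrappedRank, Fin.ext_iff]
  have hr2 : wrappedRank (m + 1) 2 (.inr 2) = m + 5 := by simp [wrappedRank]
  have hr_zero : wrappedRank (m + 1) 2 (.inl 0) = 0 := by simp [wrappedRank]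
  have hr_pos : ∀ i, i ≠ 0 → wrappedRank (m + 1) 2 (.inl i) = i + 3 := fun i hi => by
    simp [wrappedRank, hi]
  have hr_le : ∀ i, wrappedRank (m + 1) 2 (.inl i) < m + 5 := fun i => by
    have := i.isLt
    rcases eq_or_ne i 0 with rfl | hi
    · rw [hr_zero]; omega
    · rw [hr_pos i hi]; omega
  have h₁ : ∀ i j, M.underlying₁.A i j = ∑ p, ∑ q, M.a i p q * if p = j then 1 else 0 :=
    M.underlying₁_A_apply
  have h₂ : ∀ i j, M.underlying₂.A i j = ∑ p, ∑ q, M.a i p q * if q = j then 1 else 0 :=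
    M.underlying₂_A_apply
  have h₁_inl : ∀ i j, M.underlying₁.A (.inl i) j = (∑ k, E.A i k) * (if .inr 0 = j then 1 else 0)
      + (∑ k, e i k) * ((if .inr 1 = j then 1 else 0) - if .inr 0 = j then 1 else 0) :=
    fun i j => by
      rw [h₁, wrapped₃_sum_inl lam w E e β i fun p _ => if p = j then 1 else 0, Finset.sum_mul,
        Finset.sum_mul]
  have h₁_zero : ∀ j, M.underlying₁.A (.inr 0) j = lam * if .inr 0 = j then 1 else 0 := fun j => by
    rw [h₁, wrapped₃_sum_inr_zero lam w E e β fun p _ => if p = j then 1 else 0]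
  have h₁_one : ∀ j, M.underlying₁.A (.inr 1) j =
      (1 - lam) / 2 * (if .inr 0 = j then 1 else 0) + lam * if .inr 1 = j then 1 else 0 :=
    fun j => by
      rw [h₁, wrapped₃_sum_inr_one lam w E e β hw fun p _ => if p = j then 1 else 0]
      ring
  have h₁_two : ∀ j, M.underlying₁.A (.inr 2) j =
      (∑ k, E.b k) * (if .inr 0 = j then 1 else 0)
      + (∑ k, β k) * ((if .inr 1 = j then 1 else 0) - if .inr 0 = j then 1 else 0)
      + lam * ((if .inr 2 = j then 1 else 0) - if .inr 0 = j then 1 else 0) := fun j => by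
    rw [h₁]
    refine (wrapped₃_sum_b lam w E e β fun p _ => if p = j then 1 else 0).trans ?_
    rw [Finset.sum_mul, Finset.sum_mul]
  have h₂_inl : ∀ i j, M.underlying₂.A (.inl i) j = ∑ k, E.A i k * if .inl k = j then 1 else 0 :=
    fun i j => by
      rw [h₂, wrapped₃_sum_inl lam w E e β i fun _ q => if q = j then 1 else 0]
      simp
  have h₂_zero : ∀ j, M.underlying₂.A (.inr 0) j = lam * if .inl 0 = j then 1 else 0 := fun j => by
    rw [h₂, wrapped₃_sum_inr_zero lam w E e β fun _ q => if q = j then 1 else 0]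
  have h₂_one : ∀ j, M.underlying₂.A (.inr 1) j =
      ((1 - lam) / 2 - coupling₃₂₂ lam w) * (if .inl 0 = j then 1 else 0)
        + coupling₃₂₂ lam w * (if .inr 0 = j then 1 else 0)
        + lam * (if (if w = 1 then .inl 0 else .inr 0) = j then 1 else 0) := fun j => by
    rw [h₂, wrapped₃_sum_inr_one lam w E e β hw fun _ q => if q = j then 1 else 0]
  have h₂_two : ∀ j, M.underlying₂.A (.inr 2) j = ∑ k, E.b k * if .inl k = j then 1 else 0 :=
    fun j => by
      rw [h₂]
      refine (wrapped₃_sum_b lam w E e β fun _ q => if q = j then 1 else 0).trans ?_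
      simp
  have hcases : ∀ i : Fin 3, i = 0 ∨ i = 1 ∨ i = 2 := fun i => by fin_cases i <;> simp
  refine ⟨?_, ?_, ?_⟩
  · rintro (i | i) j hij h
    · rcases eq_or_ne i 0 with rfl | hi
      · simp [h₁_inl, hE 0 _ (Fin.zero_le _), he]
      · rw [hr_pos i hi] at h
        have hj0 : .inr 0 ≠ j := by rintro rfl; rw [hr0] at h; omega
        have hj1 : .inr 1 ≠ j := by rintro rfl; rw [hr1] at h; omega
        simp [h₁_inl, hj0, hj1]
    · obtain rfl | rfl | rfl := hcases i
      · simp [h₁_zero, hij.symm]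
      · have hj0 : .inr 0 ≠ j := by rintro rfl; rw [hr0, hr1] at h; omega
        simp [h₁_one, hij.symm, hj0]
      · have hj0 : .inr 0 ≠ j := by rintro rfl; rw [hr0, hr2] at h; omega
        have hj1 : .inr 1 ≠ j := by rintro rfl; rw [hr1, hr2] at h; omega
        simp [h₁_two, hij.symm, hj0, hj1]
  · rintro (i | i) j h
    · rw [h₂_inl]
      refine Finset.sum_eq_zero fun k _ => ?_
      split_ifs with hkj
      · rw [hE i k (le_of_wrappedRank_inl_le (hkj ▸ h)), zero_mul]
      · rw [mul_zero]
    · obtain rfl | rfl | rfl := hcases i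
      · have hj : .inl 0 ≠ j := by rintro rfl; rw [hr0, hr_zero] at h; omega
        simp [h₂_zero, hj]
      · have hj : .inl 0 ≠ j := by rintro rfl; rw [hr1, hr_zero] at h; omega
        have hj0 : .inr 0 ≠ j := by rintro rfl; rw [hr1, hr0] at h; omega
        rcases hw with rfl | rfl <;> simp [h₂_one, hj, hj0]
      · have hj : ∀ k, .inl k ≠ j := by
          rintro k rfl
          have := hr_le k
          omega
        simp [h₂_two, hj]
  · rintro (j | j) hj i
    · rcases i with i | i
      · simp [h₁_inl]
      · obtain rfl | rfl | rfl := hcases i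
        · simp [h₁_zero]
        · simp [h₁_one]
        · simp [h₁_two]
    · refine absurd hj ?_
      obtain rfl | rfl | rfl := hcases j
      · simpa [h₁_zero] using hlam0
      · simpa [h₁_one] using hlam0
      · simpa [h₁_two] using hlam0

theorem sdirk₃_c_zero (lam : ℝ) : (sdirk₃ lam).c 0 = lam := by
  simp [RKMethod.c, sdirk₃, Fin.sum_univ_three]

theorem sdirk₃_c_one (lam : ℝ) : (sdirk₃ lam).c 1 = (1 + lam) / 2 := by
  simp [RKMethod.c, sdirk₃, Fin.sum_univ_three]
  ring

/-- The coefficient `couplingExpl` is the one for which the condition on `b i j * a j k l * c k`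
holds. -/
theorem implicitlyWrapped₃_sum_coupling (hb : E.b (Fin.last (m + 1)) ≠ 0) (h1 : lam ≠ 1) :
    (1 - lam) / 2 * ∑ i, E.b i * ∑ k, (if i = Fin.last (m + 1) ∧ k = (Fin.last m).castSucc then
      couplingExpl lam E else 0) = (1 - 3 * lam) / 6 := by
  have h1' : 1 - lam ≠ 0 := sub_ne_zero.2 h1.symm
  simp only [ite_and, Finset.sum_ite_irrel, Finset.sum_ite_eq', Finset.mem_univ, if_true,
    Finset.sum_const_zero, mul_ite, mul_zero]
  rw [couplingExpl, sdirk₃_c_zero, sdirk₃_c_one,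
    show (1 + lam) / 2 - lam = (1 - lam) / 2 by ring]
  field_simp

/-- The coefficient `couplingOut` is the one for which the condition on `b i j * c i * c j` holds.
As `E.c 0 = 0`, it enters only through the weight of the last explicit stage. -/
theorem implicitlyWrapped₃_sum_out_c (hE : E.IsExplicit) (hc : E.c (Fin.last (m + 1)) ≠ 0)
    (h1 : lam ≠ 1) :
    (1 - lam) / 2 * ∑ k, ((if k = 0 then couplingOut lam E else 0) + if k = Fin.last (m + 1) then
      (6 * lam ^ 2 - 20 * lam + 5) / 4 - couplingOut lam E else 0) * E.c k =
      1 / 3 - lam / 2 - lam * (1 - lam) * E.c (Fin.last (m + 1)) := by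
  have h1' : lam - 1 ≠ 0 := sub_ne_zero.2 h1
  simp only [add_mul, ite_mul, zero_mul, Finset.sum_add_distrib, Finset.sum_ite_eq',
    Finset.mem_univ, if_true, hE.c_zero, mul_zero, zero_add]
  rw [couplingOut, sdirk₃_c_zero, sdirk₃_c_one, show lam - (1 + lam) / 2 = (lam - 1) / 2 by ring]
  simp only [sdirk₃, Matrix.of_apply, Matrix.cons_val]
  field_simp
  ring

/-- A sum over the stages of the explicit method with the first and the last term replaced. -/
theorem sum_ite_first_last (x y : ℝ) (u v : Fin (m + 2) → ℝ) :
    ∑ k, (if k = 0 then x else if k = Fin.last (m + 1) then y else u k) * v k =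
      ∑ k, u k * v k + (x - u 0) * v 0 + (y - u (Fin.last (m + 1))) * v (Fin.last (m + 1)) := by
  have h : ∀ k : Fin (m + 2), (if k = 0 then x else if k = Fin.last (m + 1) then y else u k) * v k
      = u k * v k + (if k = 0 then (x - u k) * v k else 0)
        + if k = Fin.last (m + 1) then (y - u k) * v k else 0 := by
    intro k
    by_cases h0 : k = 0
    · subst h0
      simp [Fin.ext_iff]
      ring
    · by_cases h1 : k = Fin.last (m + 1) <;> simp [h0, h1]
      ring
  simp [h, Finset.sum_add_distrib]

theorem implicitlyWrapped₃'_sum_out (hb : ∑ i, E.b i = 1) :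
    ∑ k, (if k = 0 then couplingOut' lam E else if k = Fin.last (m + 1) then
      couplingX₁ lam E - couplingOut' lam E else E.b k * couplingDelta lam) =
      (6 * lam ^ 2 - 20 * lam + 5) / 4 := by
  have h := sum_ite_first_last (couplingOut' lam E) (couplingX₁ lam E - couplingOut' lam E)
    (fun k => E.b k * couplingDelta lam) fun _ => 1
  simp only [mul_one] at h
  rw [h, ← Finset.sum_mul, hb, couplingX₁]
  simp only [sdirk₃, Matrix.of_apply, Matrix.cons_val]
  ring

/-- The coefficient `couplingOut'` is the one for which the condition on `b i j * c i * c j`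
holds. -/
theorem implicitlyWrapped₃'_sum_out_c (hE : E.IsExplicit) (hbc : ∑ i, E.b i * E.c i = 1 / 2)
    (hc : E.c (Fin.last (m + 1)) ≠ 0) (h1 : lam ≠ 1) :
    (1 - lam) / 2 * ∑ k, (if k = 0 then couplingOut' lam E else if k = Fin.last (m + 1) then
      couplingX₁ lam E - couplingOut' lam E else E.b k * couplingDelta lam) * E.c k =
      1 / 3 - lam / 2 - lam * (1 - lam) * E.c (Fin.last (m + 1)) := by
  have h1' : lam - 1 ≠ 0 := sub_ne_zero.2 h1
  rw [sum_ite_first_last, hE.c_zero]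
  simp only [mul_right_comm _ (couplingDelta lam), ← Finset.sum_mul, hbc]
  rw [couplingOut', sdirk₃_c_zero, sdirk₃_c_one, show lam - (1 + lam) / 2 = (lam - 1) / 2 by ring]
  simp only [sdirk₃, Matrix.of_apply, Matrix.cons_val]
  field_simp
  ring

/-- The coefficient `couplingDelta` is the one for which the condition on `b i j * a j k l * c k`
holds. -/
theorem implicitlyWrapped₃'_sum_coupling (hbc : ∑ i, E.b i * E.c i = 1 / 2) (h1 : lam ≠ 1) :
    (1 - lam) / 2 * ∑ i, E.b i * ∑ k, E.A i k * couplingDelta lam = (1 - 3 * lam) / 6 := by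
  have h1' : lam - 1 ≠ 0 := sub_ne_zero.2 h1
  simp only [← Finset.sum_mul, ← mul_assoc]
  rw [show ∑ i, E.b i * ∑ k, E.A i k = 1 / 2 from hbc, couplingDelta]
  field_simp
  ring

end ThirdOrder

theorem mainTheorem7 :
    (∀ (m : ℕ) (E : RKMethod (Fin (m + 1))), E.IsExplicit → E.HasOrder 2 →
      ∀ γ : ℝ, (γ = (2 + √2) / 2 ∨ γ = (2 - √2) / 2) →
        (implicitlyWrapped₂ E γ).HasOrder 2 ∧
        (implicitlyWrapped₂ E γ).IsStifflyAccurate (Sum.inr 1) ∧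
        (implicitlyWrapped₂ E γ).IsLStableZ₁) ∧
    (∀ lam : ℝ, 1 / 6 - 3 / 2 * lam + 3 * lam ^ 2 - lam ^ 3 = 0 →
      0.4358 < lam → lam < 0.4359 →
      ∀ w : ℕ, (w = 1 ∨ w = 2) →
      ∀ (m : ℕ) (E : RKMethod (Fin (m + 2))), E.IsExplicit → E.HasOrder 3 →
        E.c (Fin.last (m + 1)) ≠ 0 →
        (E.b (Fin.last (m + 1)) ≠ 0 →
          (implicitlyWrapped₃ lam w E).HasOrder 3 ∧
          (implicitlyWrapped₃ lam w E).IsStifflyAccurate (Sum.inr 2) ∧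
          (implicitlyWrapped₃ lam w E).IsLStableZ₁) ∧
        ((implicitlyWrapped₃' lam w E).HasOrder 3 ∧
          (implicitlyWrapped₃' lam w E).IsStifflyAccurate (Sum.inr 2) ∧
          (implicitlyWrapped₃' lam w E).IsLStableZ₁)) := by
  refine ⟨fun m E hE hord γ hγ => ?_, fun lam hlam hlo hhi w hw m E hE hord hc => ?_⟩
  · have hs : √2 ^ 2 = (2 : ℝ) := Real.sq_sqrt (by norm_num)
    have hγ2 : 2 * γ - γ ^ 2 = 1 / 2 := by
      rcases hγ with rfl | rfl <;> linear_combination (-1 / 4 : ℝ) * hs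
    have hγ0 : γ ≠ 0 := by
      rintro rfl
      norm_num at hγ2
    have hacc : (implicitlyWrapped₂ E γ).IsStifflyAccurate (Sum.inr 1) := fun _ _ => rfl
    refine ⟨(implicitlyWrapped₂_secondOrderConditions (hord.sum_b (by norm_num))
      (hord.sum_b_c le_rfl) hγ2).hasOrder, hacc,
      (implicitlyWrapped₂_isStiffTriangular hE hγ0).isLStableZ₁ hacc ?_⟩
    simpa [NPRKMethod.underlying₁, implicitlyWrapped₂, Fintype.sum_sum_type] using hγ0
  · have hlam0 : lam ≠ 0 := by intro h; norm_num [h] at hlo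
    have hlam1 : lam ≠ 1 := by intro h; norm_num [h] at hhi
    have hlam' : 6 * lam ^ 2 - 20 * lam + 5 ≠ 0 := by
      apply ne_of_lt
      nlinarith
    have hb := hord.sum_b (by norm_num)
    have hbc := hord.sum_b_c (by norm_num)
    have hlast : ∀ e β, (wrapped₃ lam w E e β).underlying₁.A (.inr 2) (.inr 2) ≠ 0 := fun e β => by
      simpa [NPRKMethod.underlying₁, wrapped₃, Fintype.sum_sum_type] using hlam0
    have hacc : ∀ e β, (wrapped₃ lam w E e β).IsStifflyAccurate (.inr 2) := fun _ _ _ _ => rfl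
    refine ⟨fun hbn => ?_, ?_⟩
    · rw [implicitlyWrapped₃_eq]
      refine ⟨(wrapped₃_thirdOrderConditions hlam hlam0 hlam' hw hE hb hbc
        (hord.sum_b_c_sq le_rfl) (hord.sum_b_A_c le_rfl) ?_
        (implicitlyWrapped₃_sum_out_c hE hc hlam1)
        (implicitlyWrapped₃_sum_coupling hbn hlam1)).hasOrder, hacc _ _,
        (wrapped₃_isStiffTriangular hlam0 hw hE fun k => ?_).isLStableZ₁ (hacc _ _) (hlast _ _)⟩
      · simp [Finset.sum_add_distrib]
      · simp [Fin.ext_iff]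
    · rw [implicitlyWrapped₃'_eq]
      refine ⟨(wrapped₃_thirdOrderConditions hlam hlam0 hlam' hw hE hb hbc
        (hord.sum_b_c_sq le_rfl) (hord.sum_b_A_c le_rfl) (implicitlyWrapped₃'_sum_out hb)
        (implicitlyWrapped₃'_sum_out_c hE hbc hc hlam1)
        (implicitlyWrapped₃'_sum_coupling hbc hlam1)).hasOrder, hacc _ _,
        (wrapped₃_isStiffTriangular hlam0 hw hE fun k => ?_).isLStableZ₁ (hacc _ _) (hlast _ _)⟩
      simp [hE 0 k (Fin.zero_le k)]
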